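/- **Definitions.** A lattice $\Lambda\subset\mathbb R^3$ is the set of all integer combinations of a linear basis of $\mathbb R^3$. Lattices $\Lambda,\Lambda'$ are isometric if $f(\Lambda)=\Lambda'$ for some distance-preserving map $f:\mathbb R^3\to\mathbb R^3$. An obtuse superbase $B=(v_0,v_1,v_2,v_3)$ consists of a basis $v_1,v_2,v_3$ of $\mathbb R^3$ and $v_0=-v_1-v_2-v_3$ such that all conorms $p_{ij}=-v_i\cdot v_j$ ($i\ne j$) are non-negative; it generates the lattice with basis $v_1,v_2,v_3$. Its root products are $r_{ij}=r_{ji}=\sqrt{p_{ij}}$, written as the matrix $\begin{pmatrix} r_{23}&r_{13}&r_{12}\\ r_{01}&r_{02}&r_{03}\end{pmatrix}$, on which the 24 permutations of the indices $0,1,2,3$ (index-permutations) act. The Voronoi type of $\Lambda$ is the combinatorial type (face lattice) of its Voronoi domain $\{p\in\mathbb R^3 : |p|\le|p-v| \text{ for all } v\in\Lambda\}$: $V_1$ a truncated octahedron, $V_2$ a hexa-rhombic (elongated) dodecahedron, $V_3$ a rhombic dodecahedron, $V_4$ a hexagonal prism, $V_5$ a cuboid. A *root arrangement* of $B$ is the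 Voronoi type of the lattice generated by $B$ together with a list of root products obtained as follows, after some index-permutation. - $V_5$: exactly three root products are non-zero, in the positions $r_{01},r_{02},r_{03}$ or in the positions $r_{12},r_{02},r_{03}$; list them in increasing order. - $V_4$: exactly $r_{23}=r_{13}=0$; list $r_{12},r_{01},r_{02}$ in increasing order, followed by $r_{03}$. - $V_3$: exactly $r_{23}=r_{01}=0$; list the other four root products in increasing order. - $V_2$: exactly $r_{23}=0$; change the submatrix $\begin{pmatrix} r_{13}&r_{12}\\ r_{02}&r_{03}\end{pmatrix}$ by an element of the symmetry group $D_4$ of the square to a matrix $\begin{pmatrix} a&b\\ c&d\end{pmatrix}$ with $a=\min\{a,b,c,d\}$ and $b\le c$; list $r_{01},(a,b,c),d$. - $V_1$: no root product is zero; $r_{23}$ is the minimum of all six, $r_{13}$ is the minimum of $r_{13},r_{12},r_{02},r_{03}$; if $r_{23}=r_{13}$ then $r_{01}\le r_{02}$; if $r_{13}=r_{12}$ then $r_{02}\le r_{03}$; list $r_{23},r_{13},r_{12},r_{01},r_{02},r_{03}$. The *root invariant* $\mathrm{RI}(B)$ is the root arrangement of $B$; if equalities between root products leave several root arrangements, it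 is the one with the lexicographically smallest list. **Theorem (isometry invariance of $\mathrm{RI}$).** Every obtuse superbase $B$ has a unique root invariant $\mathrm{RI}(B)$. If obtuse superbases $B,B'$ generate isometric lattices $\Lambda,\Lambda'\subset\mathbb R^3$, respectively, then $\mathrm{RI}(B)=\mathrm{RI}(B')$; moreover, $B$ and $B'$ then have the same set of root arrangements, so the equality does not depend on how ties are broken. Hence $\mathrm{RI}$ is an isometry invariant of a lattice: there is a unique function $\Lambda\mapsto\mathrm{RI}(\Lambda)$ on all lattices in $\mathbb R^3$ such that $\mathrm{RI}(\Lambda)=\mathrm{RI}(B)$ for every obtuse superbase $B$ generating $\Lambda$, and $\mathrm{RI}(\Lambda)=\mathrm{RI}(\Lambda')$ for all isometric lattices $\Lambda,\Lambda'$. -/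

import Mathlib

open scoped RealInnerProductSpace

/-- Euclidean 3-space. -/
abbrev E3 : Type := EuclideanSpace ℝ (Fin 3)

/-- `Λ` is a lattice in `ℝ³`: the integer combinations of a linear basis of `ℝ³`. -/
def IsLattice3 (Λ : Submodule ℤ E3) : Prop :=
  ∃ b : Module.Basis (Fin 3) ℝ E3, Λ = Submodule.span ℤ (Set.range b)

/-- The type of all lattices in `ℝ³`. -/
def Lattice3 : Type := {Λ : Submodule ℤ E3 // IsLattice3 Λ}

/-- Two lattices are isometric if a distance-preserving map of `ℝ³` takes one onto the other. -/
def LatticesIsometric (Λ Λ' : Submodule ℤ E3) : Prop :=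
  ∃ f : E3 → E3, Isometry f ∧ f '' (Λ : Set E3) = (Λ' : Set E3)

/-- An (ordered) obtuse superbase `v₀, v₁, v₂, v₃` of `ℝ³`: the vectors `v₁, v₂, v₃` form a basis,
`v₀ = -v₁ - v₂ - v₃`, and all conorms `-vᵢ · vⱼ`, `i ≠ j`, are non-negative. -/
structure ObtuseSuperbase where
  v : Fin 4 → E3
  linearIndependent : LinearIndependent ℝ ![v 1, v 2, v 3]
  v_zero : v 0 = -v 1 - v 2 - v 3
  obtuse : ∀ i j : Fin 4, i ≠ j → 0 ≤ -⟪v i, v j⟫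

namespace ObtuseSuperbase

/-- The lattice generated by an obtuse superbase. -/
def lattice (B : ObtuseSuperbase) : Submodule ℤ E3 :=
  Submodule.span ℤ {B.v 1, B.v 2, B.v 3}

/-- The conorms `pᵢⱼ = -vᵢ · vⱼ` (used for `i ≠ j` only). -/
noncomputable def conorm (B : ObtuseSuperbase) (i j : Fin 4) : ℝ := -⟪B.v i, B.v j⟫

/-- The root products `rᵢⱼ = √pᵢⱼ` (used for `i ≠ j` only). -/
noncomputable def rootProduct (B : ObtuseSuperbase) (i j : Fin 4) : ℝ := √(B.conorm i j)

end ObtuseSuperbase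

/-- The Voronoi domain of a lattice: all points non-strictly closer to `0` than to any other
lattice point. -/
def voronoiDomain (Λ : Submodule ℤ E3) : Set E3 := {p | ∀ v ∈ Λ, ‖p‖ ≤ ‖p - v‖}

/-- The faces of a convex polytope (including the empty face and the polytope itself), ordered by
inclusion. Every face of a polytope is exposed. -/
abbrev FaceLattice (P : Set E3) : Type := {F : Set E3 // IsExposed ℝ P F}

/-- Combinatorial equivalence of polytopes: isomorphism of their face lattices. -/
def CombinatoriallyEquivalent (P Q : Set E3) : Prop := Nonempty (FaceLattice P ≃o FaceLattice Q)

/-- The five Voronoi types `V₁, …, V₅` of lattices in `ℝ³`. -/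
inductive VoronoiType : Type
  | V1
  | V2
  | V3
  | V4
  | V5

/-- A representative polytope of each Voronoi type.
* `V1`: the truncated octahedron with the vertices `(0, ±1, ±2)` and their permutations;
* `V2`: the hexa-rhombic (elongated) dodecahedron, with the 18 vertices
  `(±2, 0, ±1), (0, ±2, ±1), (±1, ±1, ±2), (0, 0, ±3)`;
* `V3`: the rhombic dodecahedron, with the 14 vertices
  `(±1, ±1, ±1), (±2, 0, 0), (0, ±2, 0), (0, 0, ±2)`;
* `V4`: a prism over a hexagon;
* `V5`: a cube. -/
def VoronoiType.polytope : VoronoiType → Set E3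
  | .V1 => {x | |x 0| ≤ 2 ∧ |x 1| ≤ 2 ∧ |x 2| ≤ 2 ∧ |x 0| + |x 1| + |x 2| ≤ 3}
  | .V2 => {x | |x 0| + |x 1| ≤ 2 ∧ |x 0| + |x 2| ≤ 3 ∧ |x 1| + |x 2| ≤ 3}
  | .V3 => {x | |x 0| + |x 1| ≤ 2 ∧ |x 0| + |x 2| ≤ 2 ∧ |x 1| + |x 2| ≤ 2}
  | .V4 => {x | |x 0| ≤ 1 ∧ |x 1| ≤ 1 ∧ |x 0 - x 1| ≤ 1 ∧ |x 2| ≤ 1}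
  | .V5 => {x | |x 0| ≤ 1 ∧ |x 1| ≤ 1 ∧ |x 2| ≤ 1}

/-- A lattice has Voronoi type `T` if its Voronoi domain has the combinatorial type of `T`. -/
def HasVoronoiType (Λ : Submodule ℤ E3) (T : VoronoiType) : Prop :=
  CombinatoriallyEquivalent (voronoiDomain Λ) T.polytope

/-- Two `2 × 2` matrices are related by the symmetry group `D₄` of the square acting on the four
positions: row swaps, column swaps and the transposition of the matrix. -/
def D4Related (A A' : Matrix (Fin 2) (Fin 2) ℝ) : Prop :=
  ∃ α β : Equiv.Perm (Fin 2), A' = A.submatrix α β ∨ A' = A.transpose.submatrix α β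

/-- `L'` is the list `L` written in (non-strictly) increasing order. -/
def IsIncreasingOrderOf (L' L : List ℝ) : Prop := L'.Perm L ∧ L'.Pairwise (· ≤ ·)

/-- The values of the root invariant: a Voronoi type and the ordered root products, namely
* `V1`: the `2 × 3` matrix with rows `(r₂₃, r₁₃, r₁₂)` and `(r₀₁, r₀₂, r₀₃)`, read by rows;
* `V2`: `r₀₁, (r₁₃, r₁₂, r₀₂), r₀₃` (`1 + 3 + 1` numbers);
* `V3`: four numbers in increasing order;
* `V4`: `(a, b, c), r₀₃` (`3 + 1` numbers);
* `V5`: three numbers in increasing order. -/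
@[ext]
structure RootInvariant where
  type : VoronoiType
  entries : List ℝ

instance : Nonempty RootInvariant := ⟨⟨.V1, []⟩⟩

/-- The forms that the root products may take for each Voronoi type. Here `r i j` are the root
products after an index-permutation; they make up the root form with the rows `(r₂₃, r₁₃, r₁₂)` and
`(r₀₁, r₀₂, r₀₃)`, and `L` is the list of ordered root products. -/
def OrderedRootForm (r : Fin 4 → Fin 4 → ℝ) (L : List ℝ) : VoronoiType → Prop
  | .V1 =>
      -- no zero root products
      (r 2 3 ≠ 0 ∧ r 1 3 ≠ 0 ∧ r 1 2 ≠ 0 ∧ r 0 1 ≠ 0 ∧ r 0 2 ≠ 0 ∧ r 0 3 ≠ 0) ∧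
      -- the minimum of all root products is in the top left position
      (r 2 3 ≤ r 1 3 ∧ r 2 3 ≤ r 1 2 ∧ r 2 3 ≤ r 0 1 ∧ r 2 3 ≤ r 0 2 ∧ r 2 3 ≤ r 0 3) ∧
      -- the minimum of columns 2 and 3 is in the top middle position
      (r 1 3 ≤ r 1 2 ∧ r 1 3 ≤ r 0 2 ∧ r 1 3 ≤ r 0 3) ∧
      -- if neighbours in the top row are equal, their counterparts are in increasing order
      (r 2 3 = r 1 3 → r 0 1 ≤ r 0 2) ∧ (r 1 3 = r 1 2 → r 0 2 ≤ r 0 3) ∧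
      L = [r 2 3, r 1 3, r 1 2, r 0 1, r 0 2, r 0 3]
  | .V2 =>
      -- exactly one zero root product
      (r 2 3 = 0 ∧ r 1 3 ≠ 0 ∧ r 1 2 ≠ 0 ∧ r 0 1 ≠ 0 ∧ r 0 2 ≠ 0 ∧ r 0 3 ≠ 0) ∧
      -- columns 2 and 3 may be changed by `D₄`, and are ordered
      ∃ A : Matrix (Fin 2) (Fin 2) ℝ, D4Related !![r 1 3, r 1 2; r 0 2, r 0 3] A ∧
        A 0 0 ≤ A 0 1 ∧ A 0 0 ≤ A 1 0 ∧ A 0 0 ≤ A 1 1 ∧ A 0 1 ≤ A 1 0 ∧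
        L = [r 0 1, A 0 0, A 0 1, A 1 0, A 1 1]
  | .V3 =>
      -- exactly two zero root products, in the same column
      (r 2 3 = 0 ∧ r 0 1 = 0 ∧ r 1 3 ≠ 0 ∧ r 1 2 ≠ 0 ∧ r 0 2 ≠ 0 ∧ r 0 3 ≠ 0) ∧
      IsIncreasingOrderOf L [r 1 3, r 1 2, r 0 2, r 0 3]
  | .V4 =>
      -- exactly two zero root products, in different columns
      (r 2 3 = 0 ∧ r 1 3 = 0 ∧ r 1 2 ≠ 0 ∧ r 0 1 ≠ 0 ∧ r 0 2 ≠ 0 ∧ r 0 3 ≠ 0) ∧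
      ∃ L₃ : List ℝ, IsIncreasingOrderOf L₃ [r 1 2, r 0 1, r 0 2] ∧ L = L₃ ++ [r 0 3]
  | .V5 =>
      -- exactly three non-zero root products: odd superbases
      ((r 2 3 = 0 ∧ r 1 3 = 0 ∧ r 1 2 = 0 ∧ r 0 1 ≠ 0 ∧ r 0 2 ≠ 0 ∧ r 0 3 ≠ 0) ∧
        IsIncreasingOrderOf L [r 0 1, r 0 2, r 0 3]) ∨
      -- exactly three non-zero root products: even superbases
      ((r 2 3 = 0 ∧ r 1 3 = 0 ∧ r 0 1 = 0 ∧ r 1 2 ≠ 0 ∧ r 0 2 ≠ 0 ∧ r 0 3 ≠ 0) ∧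
        IsIncreasingOrderOf L [r 1 2, r 0 2, r 0 3])

/-- `R` consists of the Voronoi type of the lattice of `B` and of the root products of `B`, ordered
by the rules for that Voronoi type after one of the 24 index-permutations. -/
def IsRootArrangement (B : ObtuseSuperbase) (R : RootInvariant) : Prop :=
  HasVoronoiType B.lattice R.type ∧
    ∃ σ : Equiv.Perm (Fin 4),
      OrderedRootForm (fun i j => B.rootProduct (σ i) (σ j)) R.entries R.type

/-- `R` is the root invariant of `B`: an arrangement of the root products as above, and, if ties
between root products leave several of these, the lexicographically smallest of them. -/
def IsRootInvariant (B : ObtuseSuperbase) (R : RootInvariant) : Prop :=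
  IsRootArrangement B R ∧ ∀ R' : RootInvariant, IsRootArrangement B R' → R.entries ≤ R'.entries

/-- The root invariant `RI(B)`, the unique `R` with `IsRootInvariant B R`. -/
noncomputable def ObtuseSuperbase.RI (B : ObtuseSuperbase) : RootInvariant :=
  Classical.epsilon (IsRootInvariant B)

/-! Fix a lattice with an obtuse superbase. By Selling's formula the shortest vectors of each class
of `Λ/2Λ` include a 0/1 combination of the superbase, and the minimal squared length (the vonorm) is
the total conorm across a cut of `{0,1,2,3}`. Vonorms depend on the lattice only. Their Fourier
transform on `𝔽₂³`, viewed as the even subsets of `{0,1,2,3}`, is the conorm function: it takes the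
value `pᵢⱼ` at `{i,j}` and `0` at the full set. Hence the conorm functions of two obtuse superbases
of one lattice differ by a linear automorphism of `𝔽₂³` (`exists_conormFunction_automorphism`).

If that automorphism fixes the full set, it is an index-permutation. Otherwise some further conorm
vanishes, and a check of the possible root forms (`exists_conormMap_of_apply_eq_zero`) gives an
automorphism that moves the full set to the second zero and keeps the form. Composing the two yields
an index-permutation, so both superbases have the same root arrangements
(`HasRootForm.of_conorm_automorphism`).

The Voronoi type adds no condition. The Voronoi domain is the graphical zonotope of the conorms, and
its face lattice depends only on which conorms vanish. Comparison with explicit reference polytopes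
then shows that each zero pattern forces its type.

A root arrangement exists because the graph of non-zero conorms is connected: an empty cut would
make a proper partial sum of the superbase vanish. There are six connected graphs on four vertices,
each matching one case. Finiteness gives a smallest list, and a list determines its type. Selling's
reduction supplies an obtuse superbase for every lattice, and isometries carry superbases along. -/

/-! ### Face lattices of polytopes from vertex-facet incidences. -/

section FaceLattice

/-- The closed sets of the Galois connection of an incidence relation, together with `∅`. -/
def IncidenceClosed {I J : Type*} (inc : I → J → Prop) (S : Set I) : Prop :=
  S = ∅ ∨ ∀ i, (∀ j, (∀ k ∈ S, inc k j) → inc i j) → i ∈ S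

variable {E : Type*} [NormedAddCommGroup E] [NormedSpace ℝ E]

/-- A point of the face is a convex combination of the `v i`; the exposing functional is maximal
there, so it is maximal at every `v i` of non-zero weight. -/
theorem IsExposed.eq_convexHull {P F : Set E} {I : Type*} {v : I → E}
    (hF : IsExposed ℝ P F) (hP : P = convexHull ℝ (Set.range v)) :
    F = convexHull ℝ (v '' {i | v i ∈ F}) := by
  classical
  have hPc : Convex ℝ P := hP ▸ convex_convexHull ℝ _
  apply Set.Subset.antisymm
  · intro x hx
    obtain ⟨l, hl⟩ := hF ⟨x, hx⟩
    have hxP : x ∈ P := hF.subset hx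
    rw [hP, convexHull_range_eq_exists_affineCombination] at hxP
    obtain ⟨s, w, hw0, hw1, hxw⟩ := hxP
    rw [Finset.affineCombination_eq_linear_combination _ _ _ hw1] at hxw
    have hvP : ∀ i, v i ∈ P := fun i => hP ▸ subset_convexHull ℝ _ ⟨i, rfl⟩
    have hmax : ∀ y ∈ P, l y ≤ l x := by rw [hl] at hx; exact hx.2
    have hzero : ∑ i ∈ s, w i * (l x - l (v i)) = 0 := by
      have : l x = ∑ i ∈ s, w i * l (v i) := by
        conv_lhs => rw [← hxw]
        simp [map_sum]
      simp only [mul_sub, Finset.sum_sub_distrib, ← Finset.sum_mul, hw1, one_mul]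
      linarith
    rw [Finset.sum_eq_zero_iff_of_nonneg
      (fun i hi => mul_nonneg (hw0 i hi) (sub_nonneg.2 (hmax _ (hvP i))))] at hzero
    rw [← hxw, ← Finset.sum_filter_of_ne (p := fun i => v i ∈ F)]
    · refine (convex_convexHull ℝ _).sum_mem (fun i hi => hw0 i (Finset.mem_filter.1 hi).1) ?_
        (fun i hi => subset_convexHull ℝ _ ⟨i, (Finset.mem_filter.1 hi).2, rfl⟩)
      rw [← hw1]
      refine Finset.sum_filter_of_ne fun i hi hne => ?_
      have := (mul_eq_zero.1 (hzero i hi)).resolve_left hne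
      rw [hl]
      exact ⟨hvP i, fun y hy => (hmax y hy).trans (by linarith)⟩
    · intro i hi hne
      have := (mul_eq_zero.1 (hzero i hi)).resolve_left (fun h => hne (by rw [h, zero_smul]))
      rw [hl]
      exact ⟨hvP i, fun y hy => (hmax y hy).trans (by linarith)⟩
  · refine convexHull_min ?_ (hF.convex hPc)
    rintro _ ⟨i, hi, rfl⟩
    exact hi

/-- If every inequality tight on the vertices of `F` is tight at `v i`, a short step from their
centroid away from `v i` stays in `P`. The exposing functional cannot increase along it, so `v i` is
also a maximiser. -/
theorem IsExposed.incidenceClosed {P F : Set E} {I J : Type*} [Finite I] [Finite J]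
    {v : I → E} {a : J → E →L[ℝ] ℝ} {b : J → ℝ}
    (hF : IsExposed ℝ P F) (hP : P = convexHull ℝ (Set.range v))
    (hPa : P = {x | ∀ j, a j x ≤ b j}) :
    IncidenceClosed (fun i j => a j (v i) = b j) {i | v i ∈ F} := by
  classical
  cases nonempty_fintype I
  rcases Set.eq_empty_or_nonempty {i | v i ∈ F} with h | ⟨k₀, hk₀⟩
  · exact Or.inl h
  right
  intro i hi
  have hvP : ∀ i, v i ∈ P := fun i => hP ▸ subset_convexHull ℝ _ ⟨i, rfl⟩
  have hva : ∀ i j, a j (v i) ≤ b j := fun i => by have := hvP i; rw [hPa] at this; exact this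
  obtain ⟨l, hl⟩ := hF ⟨_, hk₀⟩
  have hmax : ∀ k, v k ∈ F → ∀ y ∈ P, l y ≤ l (v k) := fun k hk => by rw [hl] at hk; exact hk.2
  set s : Finset I := Finset.univ.filter (fun k => v k ∈ F) with hs
  have hk₀s : k₀ ∈ s := by simpa [hs] using hk₀
  have hlF : ∀ k ∈ s, l (v k) = l (v k₀) := fun k hk => by
    have hk : v k ∈ F := by simpa [hs] using hk
    exact le_antisymm (hmax _ hk₀ _ (hvP k)) (hmax _ hk _ (hvP k₀))
  obtain ⟨n, hnd⟩ : ∃ n : ℝ, n = s.card := ⟨_, rfl⟩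
  have hn : 0 < n := by rw [hnd]; exact_mod_cast Finset.card_pos.2 ⟨_, hk₀s⟩
  -- a small step from the centre of the face away from `v i` stays inside
  have hstep : ∃ ε : ℝ, 0 < ε ∧
      ∀ j, (1 + ε) * (n⁻¹ * ∑ k ∈ s, a j (v k)) - ε * a j (v i) ≤ b j := by
    have hj : ∀ j, ∀ᶠ ε in nhdsWithin (0 : ℝ) (Set.Ioi 0),
        (1 + ε) * (n⁻¹ * ∑ k ∈ s, a j (v k)) - ε * a j (v i) ≤ b j := by
      intro j
      by_cases hjF : ∀ k, v k ∈ F → a j (v k) = b j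
      · have h1 : ∑ k ∈ s, a j (v k) = n * b j := by
          rw [Finset.sum_congr rfl (g := fun _ => b j)
            (fun k hk => hjF k (by simpa [hs] using hk))]
          simp [hnd]
        have h2 := hi j hjF
        refine Filter.Eventually.of_forall fun ε => ?_
        rw [h1, h2, inv_mul_cancel_left₀ hn.ne']
        linarith
      · push Not at hjF
        obtain ⟨k, hk, hne⟩ := hjF
        have h1 : ∑ k ∈ s, a j (v k) < n * b j := by
          have : ∑ k ∈ s, a j (v k) < ∑ k ∈ s, b j :=
            Finset.sum_lt_sum (fun k _ => hva k j)
              ⟨k, by simpa [hs] using hk, lt_of_le_of_ne (hva k j) hne⟩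
          simpa [hnd] using this
        have h2 : (1 + 0) * (n⁻¹ * ∑ k ∈ s, a j (v k)) - 0 * a j (v i) < b j := by
          have := (mul_lt_mul_iff_right₀ (inv_pos.2 hn)).2 h1
          rw [inv_mul_cancel_left₀ hn.ne'] at this
          linarith
        have hc : Continuous fun ε : ℝ =>
          (1 + ε) * (n⁻¹ * ∑ k ∈ s, a j (v k)) - ε * a j (v i) := by fun_prop
        have := (hc.tendsto 0).eventually (gt_mem_nhds h2)
        exact (this.filter_mono nhdsWithin_le_nhds).mono fun ε h => h.le
    have := (Filter.eventually_all.2 hj).and (self_mem_nhdsWithin (s := Set.Ioi (0 : ℝ)))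
    obtain ⟨ε, h1, h2⟩ := this.exists
    exact ⟨ε, h2, h1⟩
  obtain ⟨ε, hε, hεj⟩ := hstep
  set y : E := (1 + ε) • (n⁻¹ • ∑ k ∈ s, v k) - ε • v i with hy
  have hyP : y ∈ P := by
    rw [hPa]
    intro j
    simpa [hy, map_sum] using hεj j
  have hly : l y = (1 + ε) * l (v k₀) - ε * l (v i) := by
    have : ∑ k ∈ s, l (v k) = n * l (v k₀) := by
      rw [Finset.sum_congr rfl hlF]; simp [hnd]
    simp only [hy, map_sub, map_smul, map_sum, smul_eq_mul, this]
    rw [inv_mul_cancel_left₀ hn.ne']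
  have h3 := hmax _ hk₀ y hyP
  rw [hly] at h3
  have h4 : l (v k₀) ≤ l (v i) := by nlinarith
  change v i ∈ F
  rw [hl]
  exact ⟨hvP i, fun z hz => (hmax _ hk₀ z hz).trans h4⟩

/-- The sum of the functionals tight on `S` is maximal on `P` exactly where all of them are tight,
so it exposes the wanted face. -/
theorem exists_isExposed_of_incidenceClosed {P : Set E} {I J : Type*} [Finite J]
    {v : I → E} {a : J → E →L[ℝ] ℝ} {b : J → ℝ}
    (hv : ∀ i, v i ∈ P) (hPa : P = {x | ∀ j, a j x ≤ b j}) {S : Set I}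
    (hS : IncidenceClosed (fun i j => a j (v i) = b j) S) :
    ∃ F, IsExposed ℝ P F ∧ {i | v i ∈ F} = S := by
  classical
  cases nonempty_fintype J
  rcases Set.eq_empty_or_nonempty S with rfl | ⟨k₀, hk₀⟩
  -- `IsExposed` asks for a functional only when the set is non-empty, so `∅` is a face.
  · exact ⟨∅, fun h => absurd h (by simp), by simp⟩
  have hS := hS.resolve_left (Set.nonempty_iff_ne_empty.1 ⟨k₀, hk₀⟩)
  set t : Finset J := Finset.univ.filter (fun j => ∀ k ∈ S, a j (v k) = b j) with ht
  have hmt : ∀ j, j ∈ t ↔ ∀ k ∈ S, a j (v k) = b j := by simp [ht]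
  have hle : ∀ x ∈ P, ∀ j, a j x ≤ b j := fun x hx => by rw [hPa] at hx; exact hx
  have hkey : ∀ x ∈ P, (∀ y ∈ P, (∑ j ∈ t, a j) y ≤ (∑ j ∈ t, a j) x) ↔
      ∀ j ∈ t, a j x = b j := by
    intro x hx
    simp only [sum_apply]
    constructor
    · intro h
      have h1 := h _ (hv k₀)
      rw [Finset.sum_congr rfl (fun j hj => (hmt j).1 hj k₀ hk₀)] at h1
      exact (Finset.sum_eq_sum_iff_of_le (fun j _ => hle x hx j)).1
        (le_antisymm (Finset.sum_le_sum fun j _ => hle x hx j) h1)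
    · intro h y hy
      rw [Finset.sum_congr rfl h]
      exact Finset.sum_le_sum fun j _ => hle y hy j
  refine ⟨{x ∈ P | ∀ y ∈ P, (∑ j ∈ t, a j) y ≤ (∑ j ∈ t, a j) x}, fun _ => ⟨_, rfl⟩, ?_⟩
  ext i
  simp only [Set.mem_ofPred_eq]
  constructor
  · rintro ⟨h1, h2⟩
    exact hS i fun j hj => (hkey _ h1).1 h2 j ((hmt j).2 hj)
  · intro hi
    exact ⟨hv i, (hkey _ (hv i)).2 fun j hj => (hmt j).1 hj i hi⟩

/-- The face lattice of a polytope is determined by its vertex-facet incidences. -/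
theorem nonempty_faces_orderIso_incidenceClosed {P : Set E} {I J : Type*} [Finite I] [Finite J]
    {v : I → E} {a : J → E →L[ℝ] ℝ} {b : J → ℝ}
    (hP : P = convexHull ℝ (Set.range v)) (hPa : P = {x | ∀ j, a j x ≤ b j}) :
    Nonempty ({F : Set E // IsExposed ℝ P F} ≃o
      {S : Set I // IncidenceClosed (fun i j => a j (v i) = b j) S}) := by
  let φ : {F : Set E // IsExposed ℝ P F} →
      {S : Set I // IncidenceClosed (fun i j => a j (v i) = b j) S} :=
    fun F => ⟨{i | v i ∈ F.1}, F.2.incidenceClosed hP hPa⟩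
  have hφ : ∀ F G, φ F ≤ φ G ↔ F ≤ G := by
    intro F G
    constructor
    · intro h
      change F.1 ⊆ G.1
      rw [F.2.eq_convexHull hP, G.2.eq_convexHull hP]
      exact convexHull_mono (Set.image_mono h)
    · intro h i hi
      exact h hi
  have hv : ∀ i, v i ∈ P := fun i => hP ▸ subset_convexHull ℝ _ ⟨i, rfl⟩
  have hsurj : Function.Surjective φ := by
    rintro ⟨S, hS⟩
    obtain ⟨F, hF, h⟩ := exists_isExposed_of_incidenceClosed hv hPa hS
    exact ⟨⟨F, hF⟩, Subtype.ext h⟩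
  exact ⟨RelIso.ofSurjective (OrderEmbedding.ofMapLEIff φ hφ) hsurj⟩

end FaceLattice

/-! ### Graphical zonotopes of weighted graphs on four vertices. -/

section GraphZonotope

/-- The weight of the edges leaving a set of vertices of a weighted complete graph. -/
def cutWeight (p : Fin 4 → Fin 4 → ℝ) (S : Finset (Fin 4)) : ℝ := ∑ i ∈ S, ∑ j ∈ Sᶜ, p i j

/-- The graphical zonotope of the weights `p`, in the coordinates `⟪u i, x⟫`. -/
def graphZonotope (u : Fin 4 → E3) (p : Fin 4 → Fin 4 → ℝ) : Set E3 :=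
  {x | ∀ S : Finset (Fin 4), ∑ i ∈ S, ⟪u i, x⟫ ≤ cutWeight p S / 2}

/-- The sign of the pair `i, j` in the linear order given by a permutation. -/
def orderSign (π : Equiv.Perm (Fin 4)) (i j : Fin 4) : ℝ :=
  if π i < π j then 1 else if π j < π i then -1 else 0

/-- The coordinates of the vertex of the graphical zonotope given by a linear order. -/
noncomputable def orderVertex (p : Fin 4 → Fin 4 → ℝ) (π : Equiv.Perm (Fin 4)) (i : Fin 4) : ℝ :=
  (∑ j, orderSign π i j * p i j) / 2

theorem orderSign_antisymm (π : Equiv.Perm (Fin 4)) (i j : Fin 4) :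
    orderSign π j i = -orderSign π i j := by
  unfold orderSign
  rcases lt_trichotomy (π i) (π j) with h | h | h <;> simp [h, h.not_gt]

theorem orderSign_le_one (π : Equiv.Perm (Fin 4)) (i j : Fin 4) : orderSign π i j ≤ 1 := by
  unfold orderSign
  split_ifs <;> norm_num

theorem orderSign_eq_one_iff (π : Equiv.Perm (Fin 4)) (i j : Fin 4) :
    orderSign π i j = 1 ↔ π i < π j := by
  unfold orderSign
  split_ifs with h1 h2 <;> norm_num [h1]

variable {p : Fin 4 → Fin 4 → ℝ}

/-- Terms with both indices in `S` cancel, since the sign is antisymmetric and `p` symmetric. -/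
theorem sum_orderVertex (hp : ∀ i j, p i j = p j i) (π : Equiv.Perm (Fin 4))
    (S : Finset (Fin 4)) :
    ∑ i ∈ S, orderVertex p π i = (∑ i ∈ S, ∑ j ∈ Sᶜ, orderSign π i j * p i j) / 2 := by
  have h0 : ∑ i ∈ S, ∑ j ∈ S, orderSign π i j * p i j = 0 := by
    have h := Finset.sum_comm (s := S) (t := S) (f := fun i j => orderSign π i j * p i j)
    have h' : ∑ y ∈ S, ∑ x ∈ S, orderSign π x y * p x y =
        -∑ y ∈ S, ∑ x ∈ S, orderSign π y x * p y x := by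
      simp only [← Finset.sum_neg_distrib]
      refine Finset.sum_congr rfl fun i _ => Finset.sum_congr rfl fun j _ => ?_
      rw [orderSign_antisymm, hp j i]
      ring
    linarith
  simp only [orderVertex, ← Finset.sum_div]
  congr 1
  have : ∀ i, ∑ j, orderSign π i j * p i j =
      ∑ j ∈ S, orderSign π i j * p i j + ∑ j ∈ Sᶜ, orderSign π i j * p i j :=
    fun i => (Finset.sum_add_sum_compl S _).symm
  simp only [this, Finset.sum_add_distrib, h0, zero_add]

theorem sum_orderVertex_le (hp : ∀ i j, p i j = p j i) (hp0 : ∀ i j, i ≠ j → 0 ≤ p i j)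
    (π : Equiv.Perm (Fin 4)) (S : Finset (Fin 4)) :
    ∑ i ∈ S, orderVertex p π i ≤ cutWeight p S / 2 := by
  rw [sum_orderVertex hp, cutWeight]
  gcongr with i hi j hj
  have hij : i ≠ j := fun h => by subst h; exact (Finset.mem_compl.1 hj) hi
  nlinarith [orderSign_le_one π i j, hp0 i j hij]

/-- Only the support of `p` enters the right-hand side; this is what makes the combinatorial type
depend on the zero pattern alone. -/
theorem sum_orderVertex_eq_iff (hp : ∀ i j, p i j = p j i) (hp0 : ∀ i j, i ≠ j → 0 ≤ p i j)
    (π : Equiv.Perm (Fin 4)) (S : Finset (Fin 4)) :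
    ∑ i ∈ S, orderVertex p π i = cutWeight p S / 2 ↔
      ∀ i ∈ S, ∀ j ∈ Sᶜ, p i j ≠ 0 → π i < π j := by
  have hle : ∀ i ∈ S, ∀ j ∈ Sᶜ, orderSign π i j * p i j ≤ p i j := by
    intro i hi j hj
    have hij : i ≠ j := fun h => by subst h; exact (Finset.mem_compl.1 hj) hi
    nlinarith [orderSign_le_one π i j, hp0 i j hij]
  rw [sum_orderVertex hp, cutWeight, div_left_inj' two_ne_zero,
    Finset.sum_eq_sum_iff_of_le fun i hi => Finset.sum_le_sum (hle i hi)]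
  refine forall₂_congr fun i hi => ?_
  rw [Finset.sum_eq_sum_iff_of_le (hle i hi)]
  refine forall₂_congr fun j _ => ?_
  rw [← orderSign_eq_one_iff, mul_left_eq_self₀, or_iff_not_imp_right]

variable {u : Fin 4 → E3}

/-- The coordinates `⟪u i, x⟫` identify `E3` with the hyperplane of sum zero in `ℝ⁴`. -/
theorem exists_inner_eq (hu0 : ∑ i, u i = 0) (hu : ∀ x, ∃ c : Fin 4 → ℝ, x = ∑ i, c i • u i)
    {y : Fin 4 → ℝ} (hy : ∑ i, y i = 0) : ∃ x, ∀ i, ⟪u i, x⟫ = y i := by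
  let T : E3 →ₗ[ℝ] (Fin 3 → ℝ) := LinearMap.pi fun i => (innerSL ℝ (u i.succ)).toLinearMap
  have hT : ∀ x i, T x i = ⟪u i.succ, x⟫ := fun x i => rfl
  have hsum : ∀ x, ∑ i, ⟪u i, x⟫ = 0 := fun x => by rw [← sum_inner, hu0, inner_zero_left]
  have hinj : Function.Injective T := by
    rw [injective_iff_map_eq_zero]
    intro x hx
    have h1 : ∀ i : Fin 3, ⟪u i.succ, x⟫ = 0 := fun i => by rw [← hT, hx]; rfl
    have h2 := hsum x
    rw [Fin.sum_univ_succ] at h2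
    simp only [h1, Finset.sum_const_zero, add_zero] at h2
    obtain ⟨c, hc⟩ := hu x
    rw [← inner_self_eq_zero (𝕜 := ℝ)]
    nth_rewrite 1 [hc]
    rw [sum_inner]
    refine Finset.sum_eq_zero fun i _ => ?_
    rw [inner_smul_left]
    cases i using Fin.cases <;> simp [h1, h2]
  have hsurj := (LinearMap.injective_iff_surjective_of_finrank_eq_finrank (by simp)).1 hinj
  obtain ⟨x, hx⟩ := hsurj fun i => y i.succ
  have h1 : ∀ i : Fin 3, ⟪u i.succ, x⟫ = y i.succ := fun i => by rw [← hT, hx]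
  refine ⟨x, Fin.cases ?_ h1⟩
  have h2 := hsum x
  rw [Fin.sum_univ_succ] at h2 hy
  simp only [h1] at h2
  linarith

/-- A point of a graphical zonotope is dominated by one of the vertices in each direction. -/
theorem exists_sum_mul_le_orderVertex (hu0 : ∑ i, u i = 0) (hp : ∀ i j, p i j = p j i)
    {x : E3} (hx : x ∈ graphZonotope u p) (c : Fin 4 → ℝ) :
    ∃ π, ∑ i, c i * ⟪u i, x⟫ ≤ ∑ i, c i * orderVertex p π i := by
  -- `τ` lists the indices by decreasing `c`. Abel summation then reduces the claim to the cut
  -- inequalities of the three initial segments, weighted by consecutive differences of `c`.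
  set τ := Tuple.sort (fun i => -c i) with hτ
  have hmono : Monotone ((fun i => -c i) ∘ τ) := Tuple.monotone_sort _
  refine ⟨τ⁻¹, ?_⟩
  rw [← Equiv.sum_comp τ, ← Equiv.sum_comp τ (fun i => c i * orderVertex p τ⁻¹ i)]
  have hsum : ∑ i, ⟪u (τ i), x⟫ = 0 := by
    rw [Equiv.sum_comp τ fun i => ⟪u i, x⟫, ← sum_inner, hu0, inner_zero_left]
  have hcut : ∀ S : Finset (Fin 4), ∑ i ∈ S, ⟪u (τ i), x⟫ ≤
      (∑ i ∈ S, ∑ j ∈ Sᶜ, p (τ i) (τ j)) / 2 := by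
    intro S
    have := hx (S.map τ.toEmbedding)
    have hc : (S.map τ.toEmbedding)ᶜ = Sᶜ.map τ.toEmbedding := by
      ext i; simp
    simpa only [cutWeight, hc, Finset.sum_map, Equiv.coe_toEmbedding] using this
  have hv : ∀ i, orderVertex p τ⁻¹ (τ i) = (∑ j, orderSign 1 i j * p (τ i) (τ j)) / 2 := by
    intro i
    rw [orderVertex, ← Equiv.sum_comp τ]
    have hinv : ∀ k, τ⁻¹ (τ k) = k := τ.symm_apply_apply
    simp only [orderSign, hinv, Equiv.Perm.one_apply]
    rfl
  simp only [hv]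
  have h01 := hmono (show (0 : Fin 4) ≤ 1 by decide)
  have h12 := hmono (show (1 : Fin 4) ≤ 2 by decide)
  have h23 := hmono (show (2 : Fin 4) ≤ 3 by decide)
  have c1 := hcut {0}
  have c2 := hcut {0, 1}
  have c3 := hcut {0, 1, 2}
  have e1 : ({0} : Finset (Fin 4))ᶜ = {1, 2, 3} := by decide
  have e2 : ({0, 1} : Finset (Fin 4))ᶜ = {2, 3} := by decide
  have e3 : ({0, 1, 2} : Finset (Fin 4))ᶜ = {3} := by decide
  rw [e1] at c1
  rw [e2] at c2
  rw [e3] at c3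
  have m1 : ∀ f : Fin 4 → ℝ, ∑ i ∈ {0, 1}, f i = f 0 + f 1 := fun f => by
    rw [Finset.sum_pair (by decide)]
  have m2 : ∀ f : Fin 4 → ℝ, ∑ i ∈ {2, 3}, f i = f 2 + f 3 := fun f => by
    rw [Finset.sum_pair (by decide)]
  have m3 : ∀ f : Fin 4 → ℝ, ∑ i ∈ {0, 1, 2}, f i = f 0 + f 1 + f 2 := fun f => by
    rw [Finset.sum_insert (by decide), Finset.sum_pair (by decide), add_assoc]
  have m4 : ∀ f : Fin 4 → ℝ, ∑ i ∈ {1, 2, 3}, f i = f 1 + f 2 + f 3 := fun f => by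
    rw [Finset.sum_insert (by decide), Finset.sum_pair (by decide), add_assoc]
  simp only [Finset.sum_singleton, m1, m2, m3, m4] at c1 c2 c3
  simp only [Function.comp] at h01 h12 h23
  simp only [Fin.sum_univ_four] at hsum ⊢
  have s : ∀ i j, orderSign 1 i j = if i < j then 1 else if j < i then -1 else 0 := fun _ _ => rfl
  simp only [s]
  simp only [Fin.reduceLT, if_true, if_false, Fin.isValue, lt_self_iff_false]
  have p1 := mul_le_mul_of_nonneg_left c1 (show 0 ≤ c (τ 0) - c (τ 1) by linarith)
  have p2 := mul_le_mul_of_nonneg_left c2 (show 0 ≤ c (τ 1) - c (τ 2) by linarith)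
  have p3 := mul_le_mul_of_nonneg_left c3 (show 0 ≤ c (τ 2) - c (τ 3) by linarith)
  rw [hp (τ 1) (τ 0), hp (τ 2) (τ 0), hp (τ 3) (τ 0), hp (τ 2) (τ 1), hp (τ 3) (τ 1),
    hp (τ 3) (τ 2)]
  have e : ⟪u (τ 3), x⟫ = -⟪u (τ 0), x⟫ - ⟪u (τ 1), x⟫ - ⟪u (τ 2), x⟫ := by linarith
  rw [e]
  linarith

/-- A point outside the hull would be separated from it by some `∑ c i • u i`, but in that direction
it is dominated by a vertex. -/
theorem graphZonotope_eq_convexHull (hu0 : ∑ i, u i = 0)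
    (hu : ∀ x, ∃ c : Fin 4 → ℝ, x = ∑ i, c i • u i)
    (hp : ∀ i j, p i j = p j i) (hp0 : ∀ i j, i ≠ j → 0 ≤ p i j)
    {v : Equiv.Perm (Fin 4) → E3} (hv : ∀ π i, ⟪u i, v π⟫ = orderVertex p π i) :
    graphZonotope u p = convexHull ℝ (Set.range v) := by
  apply Set.Subset.antisymm
  · intro x hx
    by_contra hxc
    obtain ⟨l, r, hl, hr⟩ := geometric_hahn_banach_closed_point (convex_convexHull ℝ _)
      ((Set.finite_range v).isCompact_convexHull (𝕜 := ℝ)).isClosed hxc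
    obtain ⟨z, rfl⟩ := (InnerProductSpace.toDual ℝ E3).surjective l
    obtain ⟨c, rfl⟩ := hu z
    obtain ⟨π, hπ⟩ := exists_sum_mul_le_orderVertex hu0 hp hx c
    have h1 := hl _ (subset_convexHull ℝ _ ⟨π, rfl⟩)
    simp only [InnerProductSpace.toDual_apply_apply, sum_inner, inner_smul_left, hv,
      RCLike.conj_to_real] at h1 hr
    linarith
  · refine convexHull_min ?_ ?_
    · rintro _ ⟨π, rfl⟩ S
      simp only [hv]
      exact sum_orderVertex_le hp hp0 π S
    · intro x hx y hy a b ha hb hab S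
      have h1 := mul_le_mul_of_nonneg_left (hx S) ha
      have h2 := mul_le_mul_of_nonneg_left (hy S) hb
      simp only [inner_add_right, inner_smul_right, Finset.sum_add_distrib, ← Finset.mul_sum]
      have : cutWeight p S / 2 = a * (cutWeight p S / 2) + b * (cutWeight p S / 2) := by
        rw [← add_mul, hab, one_mul]
      linarith

/-- Vertices are indexed by permutations with repetitions, and inequalities by all subsets,
redundant ones included; the incidence criterion tolerates both. -/
theorem exists_faceLattice_orderIso (hu0 : ∑ i, u i = 0)
    (hu : ∀ x, ∃ c : Fin 4 → ℝ, x = ∑ i, c i • u i)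
    (hp : ∀ i j, p i j = p j i) (hp0 : ∀ i j, i ≠ j → 0 ≤ p i j) :
    Nonempty (FaceLattice (graphZonotope u p) ≃o {S : Set (Equiv.Perm (Fin 4)) //
      IncidenceClosed (fun π (T : Finset (Fin 4)) =>
        ∀ i ∈ T, ∀ j ∈ Tᶜ, p i j ≠ 0 → π i < π j) S}) := by
  have : ∀ π, ∃ x, ∀ i, ⟪u i, x⟫ = orderVertex p π i := fun π =>
    exists_inner_eq hu0 hu (by rw [sum_orderVertex hp]; simp)
  choose v hv using this
  have h := nonempty_faces_orderIso_incidenceClosed (v := v)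
    (a := fun T : Finset (Fin 4) => ∑ i ∈ T, innerSL ℝ (u i)) (b := fun T => cutWeight p T / 2)
    (graphZonotope_eq_convexHull hu0 hu hp hp0 hv) (by ext x; simp [graphZonotope])
  have hinc : (fun π (T : Finset (Fin 4)) =>
      (∑ i ∈ T, innerSL ℝ (u i)) (v π) = cutWeight p T / 2) =
      fun π T => ∀ i ∈ T, ∀ j ∈ Tᶜ, p i j ≠ 0 → π i < π j := by
    funext π T
    rw [← sum_orderVertex_eq_iff hp hp0]
    simp [hv]
  rw [← hinc]
  exact h

/-- Graphical zonotopes of weights with equal supports are combinatorially equivalent. -/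
theorem combinatoriallyEquivalent_graphZonotope {u' : Fin 4 → E3} {p' : Fin 4 → Fin 4 → ℝ}
    (hu0 : ∑ i, u i = 0) (hu : ∀ x, ∃ c : Fin 4 → ℝ, x = ∑ i, c i • u i)
    (hp : ∀ i j, p i j = p j i) (hp0 : ∀ i j, i ≠ j → 0 ≤ p i j)
    (hu0' : ∑ i, u' i = 0) (hu' : ∀ x, ∃ c : Fin 4 → ℝ, x = ∑ i, c i • u' i)
    (hp' : ∀ i j, p' i j = p' j i) (hp0' : ∀ i j, i ≠ j → 0 ≤ p' i j)
    (hpp' : ∀ i j, i ≠ j → (p i j = 0 ↔ p' i j = 0)) :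
    CombinatoriallyEquivalent (graphZonotope u p) (graphZonotope u' p') := by
  obtain ⟨e⟩ := exists_faceLattice_orderIso hu0 hu hp hp0
  obtain ⟨e'⟩ := exists_faceLattice_orderIso hu0' hu' hp' hp0'
  have hinc : (fun (π : Equiv.Perm (Fin 4)) (T : Finset (Fin 4)) =>
      ∀ i ∈ T, ∀ j ∈ Tᶜ, p i j ≠ 0 → π i < π j) =
      fun π T => ∀ i ∈ T, ∀ j ∈ Tᶜ, p' i j ≠ 0 → π i < π j := by
    funext π T
    refine propext (forall₂_congr fun i hi => forall₂_congr fun j hj => ?_)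
    rw [Ne, hpp' i j fun h => by subst h; exact (Finset.mem_compl.1 hj) hi]
  rw [hinc] at e
  exact ⟨e.trans e'.symm⟩

end GraphZonotope

/-! ### Selling's formula and the Voronoi domain as a graphical zonotope. -/

section VoronoiDomain

variable {u : Fin 4 → E3}

/-- Selling's formula. -/
theorem inner_sum_smul_self (hu0 : ∑ i, u i = 0) (c : Fin 4 → ℝ) :
    ⟪∑ i, c i • u i, ∑ i, c i • u i⟫ = (∑ i, ∑ j, -⟪u i, u j⟫ * (c i - c j) ^ 2) / 2 := by
  have h : ∀ i, ∑ j, ⟪u i, u j⟫ = 0 := fun i => by rw [← inner_sum, hu0, inner_zero_right]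
  have h' : ∀ i, ∑ j, ⟪u j, u i⟫ = 0 := fun i => by rw [← sum_inner, hu0, inner_zero_left]
  simp only [sum_inner, inner_sum, inner_smul_left, inner_smul_right, RCLike.conj_to_real]
  simp only [Fin.sum_univ_four] at h h' ⊢
  linear_combination (c 0 ^ 2 * (h 0 + h' 0) + c 1 ^ 2 * (h 1 + h' 1) + c 2 ^ 2 * (h 2 + h' 2) +
    c 3 ^ 2 * (h 3 + h' 3)) / 2

theorem inner_sum_self_eq_cutWeight (hu0 : ∑ i, u i = 0) (S : Finset (Fin 4)) :
    ⟪∑ i ∈ S, u i, ∑ i ∈ S, u i⟫ = cutWeight (fun i j => -⟪u i, u j⟫) S := by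
  have h : ∑ i ∈ S, u i = -∑ i ∈ Sᶜ, u i := by
    rw [eq_neg_iff_add_eq_zero, Finset.sum_add_sum_compl, hu0]
  nth_rewrite 2 [h]
  simp only [cutWeight, sum_inner, inner_sum, inner_neg_right, Finset.sum_neg_distrib]
  rw [Finset.sum_comm]

/-- Grouped by pairs, this is `±m ≤ m ^ 2` for the integers `m = n i - n j`. It shows that lattice
vectors other than partial sums of the superbase cut nothing off the zonotope. -/
theorem sum_mul_orderVertex_le {p : Fin 4 → Fin 4 → ℝ} (hp : ∀ i j, p i j = p j i)
    (hp0 : ∀ i j, i ≠ j → 0 ≤ p i j) (π : Equiv.Perm (Fin 4)) (n : Fin 4 → ℤ) :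
    ∑ i, (n i : ℝ) * orderVertex p π i ≤ (∑ i, ∑ j, p i j * ((n i : ℝ) - n j) ^ 2) / 4 := by
  set A := ∑ i, ∑ j, (n i : ℝ) * (orderSign π i j * p i j) with hA
  have h1 : ∑ i, (n i : ℝ) * orderVertex p π i = A / 2 := by
    simp only [orderVertex, hA, Finset.sum_div, Finset.mul_sum, mul_div_assoc]
  have h2 : A = -∑ i, ∑ j, (n j : ℝ) * (orderSign π i j * p i j) := by
    rw [hA, Finset.sum_comm]
    simp only [← Finset.sum_neg_distrib]
    refine Finset.sum_congr rfl fun i _ => Finset.sum_congr rfl fun j _ => ?_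
    rw [orderSign_antisymm π i j, hp i j]
    ring
  have h3 : 2 * A = ∑ i, ∑ j, ((n i : ℝ) - n j) * (orderSign π i j * p i j) := by
    simp only [sub_mul, Finset.sum_sub_distrib]
    linarith
  have h4 : 2 * A ≤ ∑ i, ∑ j, p i j * ((n i : ℝ) - n j) ^ 2 := by
    rw [h3]
    refine Finset.sum_le_sum fun i _ => Finset.sum_le_sum fun j _ => ?_
    rcases eq_or_ne i j with rfl | hij
    · simp
    have hm : ((n i : ℝ) - n j) * orderSign π i j ≤ ((n i : ℝ) - n j) ^ 2 := by
      have hs : orderSign π i j = 1 ∨ orderSign π i j = -1 ∨ orderSign π i j = 0 := by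
        unfold orderSign; split_ifs <;> simp
      have h5 : n i - n j ≤ (n i - n j) ^ 2 := Int.le_self_sq _
      have h6 : -(n i - n j) ≤ (n i - n j) ^ 2 := by
        have := Int.le_self_sq (-(n i - n j)); rwa [neg_sq] at this
      have h5' : (n i : ℝ) - n j ≤ ((n i : ℝ) - n j) ^ 2 := by exact_mod_cast h5
      have h6' : -((n i : ℝ) - n j) ≤ ((n i : ℝ) - n j) ^ 2 := by exact_mod_cast h6
      rcases hs with h | h | h <;> rw [h] <;> nlinarith
    nlinarith [mul_le_mul_of_nonneg_left hm (hp0 i j hij)]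
  rw [h1]
  linarith

/-- The inequality of a partial sum over `S` is the cut inequality of `S`. Any other lattice vector
is handled at a dominating vertex. -/
theorem voronoiDomain_eq_graphZonotope (hu0 : ∑ i, u i = 0)
    (hp0 : ∀ i j, i ≠ j → 0 ≤ -⟪u i, u j⟫) {Λ : Submodule ℤ E3}
    (hΛ : ∀ x, x ∈ Λ ↔ ∃ n : Fin 4 → ℤ, x = ∑ i, (n i : ℝ) • u i) :
    voronoiDomain Λ = graphZonotope u fun i j => -⟪u i, u j⟫ := by
  have hp : ∀ i j, -⟪u i, u j⟫ = -⟪u j, u i⟫ := fun i j => by rw [real_inner_comm]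
  have key : ∀ x v : E3, ‖x‖ ≤ ‖x - v‖ ↔ ⟪v, x⟫ ≤ ⟪v, v⟫ / 2 := by
    intro x v
    rw [← sq_le_sq₀ (norm_nonneg _) (norm_nonneg _), norm_sub_sq_real,
      real_inner_self_eq_norm_sq, real_inner_comm]
    constructor <;> intro h <;> linarith
  ext x
  simp only [voronoiDomain, Set.mem_ofPred_eq, key]
  constructor
  · intro h S
    rw [← inner_sum_self_eq_cutWeight hu0, ← sum_inner]
    refine h _ ((hΛ _).2 ⟨fun i => if i ∈ S then 1 else 0, ?_⟩)
    simp [ite_smul, Finset.sum_ite_mem]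
  · intro h v hv
    obtain ⟨n, rfl⟩ := (hΛ v).1 hv
    obtain ⟨π, hπ⟩ := exists_sum_mul_le_orderVertex hu0 hp h fun i => (n i : ℝ)
    rw [inner_sum_smul_self hu0, sum_inner]
    simp only [inner_smul_left, RCLike.conj_to_real]
    have := sum_mul_orderVertex_le hp hp0 π n
    linarith

end VoronoiDomain

/-! ### Coordinates and conorms of an obtuse superbase. -/

section Superbase

namespace ObtuseSuperbase

variable (B : ObtuseSuperbase)

theorem sum_v : ∑ i, B.v i = 0 := by
  rw [Fin.sum_univ_four, B.v_zero]; abel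

theorem exists_eq_sum_smul (x : E3) : ∃ c : Fin 4 → ℝ, x = ∑ i, c i • B.v i := by
  have h := B.linearIndependent.span_eq_top_of_card_eq_finrank' (by simp)
  have hx : x ∈ Submodule.span ℝ (Set.range ![B.v 1, B.v 2, B.v 3]) := h ▸ Submodule.mem_top
  obtain ⟨c, rfl⟩ := (Submodule.mem_span_range_iff_exists_fun ℝ).1 hx
  exact ⟨![0, c 0, c 1, c 2], by simp [Fin.sum_univ_four, Fin.sum_univ_three]⟩

theorem mem_lattice_iff (x : E3) : x ∈ B.lattice ↔
    ∃ n : Fin 3 → ℤ, x = ∑ i, (n i : ℝ) • B.v i.succ := by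
  have h : ({B.v 1, B.v 2, B.v 3} : Set E3) = Set.range fun i : Fin 3 => B.v i.succ := by
    ext y
    simp [Fin.exists_fin_succ, eq_comm]
  rw [lattice, h, Submodule.mem_span_range_iff_exists_fun]
  simp only [Int.cast_smul_eq_zsmul, eq_comm]

theorem mem_lattice_iff' (x : E3) : x ∈ B.lattice ↔
    ∃ n : Fin 4 → ℤ, x = ∑ i, (n i : ℝ) • B.v i := by
  rw [mem_lattice_iff]
  constructor
  · rintro ⟨n, rfl⟩
    refine ⟨Fin.cons 0 n, ?_⟩
    rw [Fin.sum_univ_succ (n := 3)]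
    simp only [Fin.cons_zero, Fin.cons_succ, Int.cast_zero, zero_smul, zero_add]
  · rintro ⟨n, rfl⟩
    refine ⟨fun i => n i.succ - n 0, ?_⟩
    have h := B.sum_v
    rw [Fin.sum_univ_succ, ← eq_neg_iff_add_eq_zero] at h
    rw [Fin.sum_univ_succ, h]
    simp only [Int.cast_sub, sub_smul, Finset.sum_sub_distrib, ← Finset.smul_sum, smul_neg]
    abel

theorem conorm_comm (i j : Fin 4) : B.conorm i j = B.conorm j i := by
  rw [conorm, conorm, real_inner_comm]

theorem rootProduct_comm (i j : Fin 4) : B.rootProduct i j = B.rootProduct j i := by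
  rw [rootProduct, rootProduct, conorm_comm]

theorem conorm_nonneg {i j : Fin 4} (h : i ≠ j) : 0 ≤ B.conorm i j := B.obtuse i j h

theorem rootProduct_eq_zero_iff {i j : Fin 4} (h : i ≠ j) :
    B.rootProduct i j = 0 ↔ B.conorm i j = 0 := Real.sqrt_eq_zero (B.conorm_nonneg h)

end ObtuseSuperbase

end Superbase

/-! ### The zero pattern of the root products determines the Voronoi type. -/

section ReferencePolytopes

/-- The symmetric matrix of the weights of the edges of a complete graph on four vertices. -/
def edgeWeights (p₀₁ p₀₂ p₀₃ p₁₂ p₁₃ p₂₃ : ℝ) : Fin 4 → Fin 4 → ℝ :=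
  ![![0, p₀₁, p₀₂, p₀₃], ![p₀₁, 0, p₁₂, p₁₃], ![p₀₂, p₁₂, 0, p₂₃], ![p₀₃, p₁₃, p₂₃, 0]]

/-- Complementary subsets have opposite coordinate sums and equal cuts, so the fourteen proper
non-empty subsets give seven absolute values; `∅` and the full set give `0 ≤ 0`. -/
theorem mem_graphZonotope_edgeWeights {u : Fin 4 → E3} (hu0 : ∑ i, u i = 0)
    {p₀₁ p₀₂ p₀₃ p₁₂ p₁₃ p₂₃ : ℝ} {x : E3} {y₁ y₂ y₃ : ℝ}
    (h₁ : ⟪u 1, x⟫ = y₁) (h₂ : ⟪u 2, x⟫ = y₂) (h₃ : ⟪u 3, x⟫ = y₃) :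
    x ∈ graphZonotope u (edgeWeights p₀₁ p₀₂ p₀₃ p₁₂ p₁₃ p₂₃) ↔
      |y₁ + y₂ + y₃| ≤ (p₀₁ + p₀₂ + p₀₃) / 2 ∧ |y₁| ≤ (p₀₁ + p₁₂ + p₁₃) / 2 ∧
      |y₂| ≤ (p₀₂ + p₁₂ + p₂₃) / 2 ∧ |y₃| ≤ (p₀₃ + p₁₃ + p₂₃) / 2 ∧
      |y₁ + y₂| ≤ (p₀₁ + p₀₂ + p₁₃ + p₂₃) / 2 ∧ |y₁ + y₃| ≤ (p₀₁ + p₀₃ + p₁₂ + p₂₃) / 2 ∧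
      |y₂ + y₃| ≤ (p₀₂ + p₀₃ + p₁₂ + p₁₃) / 2 := by
  have h₀ : ⟪u 0, x⟫ = -y₁ - y₂ - y₃ := by
    have : ∑ i, ⟪u i, x⟫ = 0 := by rw [← sum_inner, hu0, inner_zero_left]
    rw [Fin.sum_univ_four] at this
    linarith
  have hS : ∀ S : Finset (Fin 4), S = ∅ ∨ S = {0} ∨ S = {1} ∨ S = {2} ∨ S = {3} ∨ S = {0, 1} ∨
      S = {0, 2} ∨ S = {0, 3} ∨ S = {1, 2} ∨ S = {1, 3} ∨ S = {2, 3} ∨ S = {1, 2, 3} ∨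
      S = {0, 2, 3} ∨ S = {0, 1, 3} ∨ S = {0, 1, 2} ∨ S = {0, 1, 2, 3} := by decide
  have hf : ∀ P : Finset (Fin 4) → Prop, (∀ S, P S) ↔ P ∅ ∧ P {0} ∧ P {1} ∧ P {2} ∧ P {3} ∧
      P {0, 1} ∧ P {0, 2} ∧ P {0, 3} ∧ P {1, 2} ∧ P {1, 3} ∧ P {2, 3} ∧ P {1, 2, 3} ∧
      P {0, 2, 3} ∧ P {0, 1, 3} ∧ P {0, 1, 2} ∧ P {0, 1, 2, 3} := by
    intro P
    refine ⟨fun h => by simp only [h, and_self], ?_⟩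
    rintro ⟨h1, h2, h3, h4, h5, h6, h7, h8, h9, h10, h11, h12, h13, h14, h15, h16⟩ S
    rcases hS S with h | h | h | h | h | h | h | h | h | h | h | h | h | h | h | h <;>
      rw [h] <;> assumption
  have hc : (∅ : Finset (Fin 4))ᶜ = {0, 1, 2, 3} ∧ ({0} : Finset (Fin 4))ᶜ = {1, 2, 3} ∧
      ({1} : Finset (Fin 4))ᶜ = {0, 2, 3} ∧ ({2} : Finset (Fin 4))ᶜ = {0, 1, 3} ∧
      ({3} : Finset (Fin 4))ᶜ = {0, 1, 2} ∧ ({0, 1} : Finset (Fin 4))ᶜ = {2, 3} ∧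
      ({0, 2} : Finset (Fin 4))ᶜ = {1, 3} ∧ ({0, 3} : Finset (Fin 4))ᶜ = {1, 2} ∧
      ({1, 2} : Finset (Fin 4))ᶜ = {0, 3} ∧ ({1, 3} : Finset (Fin 4))ᶜ = {0, 2} ∧
      ({2, 3} : Finset (Fin 4))ᶜ = {0, 1} ∧ ({1, 2, 3} : Finset (Fin 4))ᶜ = {0} ∧
      ({0, 2, 3} : Finset (Fin 4))ᶜ = {1} ∧ ({0, 1, 3} : Finset (Fin 4))ᶜ = {2} ∧
      ({0, 1, 2} : Finset (Fin 4))ᶜ = {3} ∧ ({0, 1, 2, 3} : Finset (Fin 4))ᶜ = ∅ := by decide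
  have hs2 : ∀ (f : Fin 4 → ℝ) (i j : Fin 4), i ≠ j → ∑ k ∈ {i, j}, f k = f i + f j :=
    fun f i j h => Finset.sum_pair h
  have hs3 : ∀ (f : Fin 4 → ℝ) (i j k : Fin 4), i ∉ ({j, k} : Finset (Fin 4)) → j ≠ k →
      ∑ l ∈ {i, j, k}, f l = f i + (f j + f k) := fun f i j k h h' => by
    rw [Finset.sum_insert h, Finset.sum_pair h']
  have hs4 : ∀ (f : Fin 4 → ℝ), ∑ l ∈ {0, 1, 2, 3}, f l = f 0 + f 1 + f 2 + f 3 := fun f =>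
    Fin.sum_univ_four f
  change (∀ S : Finset (Fin 4), _) ↔ _
  rw [hf]
  simp only [cutWeight, hc, hs4]
  simp (discharger := decide) only [hs2, hs3, Finset.sum_singleton, Finset.sum_empty, h₀, h₁, h₂,
    h₃]
  simp only [edgeWeights, Matrix.cons_val, abs_le]
  constructor
  · rintro ⟨-, h2, h3, h4, h5, h6, h7, h8, h9, h10, h11, h12, h13, h14, h15, -⟩
    refine ⟨⟨?_, ?_⟩, ⟨?_, ?_⟩, ⟨?_, ?_⟩, ⟨?_, ?_⟩, ⟨?_, ?_⟩, ⟨?_, ?_⟩, ⟨?_, ?_⟩⟩ <;> linarith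
  · rintro ⟨⟨h1, h2⟩, ⟨h3, h4⟩, ⟨h5, h6⟩, ⟨h7, h8⟩, ⟨h9, h10⟩, ⟨h11, h12⟩, ⟨h13, h14⟩⟩
    refine ⟨?_, ?_, ?_, ?_, ?_, ?_, ?_, ?_, ?_, ?_, ?_, ?_, ?_, ?_, ?_, ?_⟩ <;> linarith

/-- The superbase with the given coordinates. -/
noncomputable def superbaseOfCoords (a b c : Fin 3 → ℝ) : Fin 4 → E3 :=
  ![-WithLp.toLp 2 a - WithLp.toLp 2 b - WithLp.toLp 2 c, WithLp.toLp 2 a, WithLp.toLp 2 b,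
    WithLp.toLp 2 c]

theorem sum_superbaseOfCoords (a b c : Fin 3 → ℝ) : ∑ i, superbaseOfCoords a b c i = 0 := by
  simp only [superbaseOfCoords, Fin.sum_univ_four, Matrix.cons_val]
  abel

theorem inner_toLp (a : Fin 3 → ℝ) (x : E3) :
    ⟪WithLp.toLp 2 a, x⟫ = a 0 * x 0 + a 1 * x 1 + a 2 * x 2 := by
  simp [PiLp.inner_apply, Fin.sum_univ_three, mul_comm]

/-- A lattice whose conorms vanish at the same positions as the weights of a graphical zonotope has
the corresponding Voronoi type. -/
theorem hasVoronoiType_of_polytope_eq (B : ObtuseSuperbase) (σ : Equiv.Perm (Fin 4))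
    {T : VoronoiType} {a b c : Fin 3 → ℝ} {p₀₁ p₀₂ p₀₃ p₁₂ p₁₃ p₂₃ : ℝ}
    (hT : ∀ x : E3, x ∈ T.polytope ↔
      |(a 0 * x 0 + a 1 * x 1 + a 2 * x 2) + (b 0 * x 0 + b 1 * x 1 + b 2 * x 2) +
        (c 0 * x 0 + c 1 * x 1 + c 2 * x 2)| ≤ (p₀₁ + p₀₂ + p₀₃) / 2 ∧
      |a 0 * x 0 + a 1 * x 1 + a 2 * x 2| ≤ (p₀₁ + p₁₂ + p₁₃) / 2 ∧
      |b 0 * x 0 + b 1 * x 1 + b 2 * x 2| ≤ (p₀₂ + p₁₂ + p₂₃) / 2 ∧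
      |c 0 * x 0 + c 1 * x 1 + c 2 * x 2| ≤ (p₀₃ + p₁₃ + p₂₃) / 2 ∧
      |(a 0 * x 0 + a 1 * x 1 + a 2 * x 2) + (b 0 * x 0 + b 1 * x 1 + b 2 * x 2)| ≤
        (p₀₁ + p₀₂ + p₁₃ + p₂₃) / 2 ∧
      |(a 0 * x 0 + a 1 * x 1 + a 2 * x 2) + (c 0 * x 0 + c 1 * x 1 + c 2 * x 2)| ≤
        (p₀₁ + p₀₃ + p₁₂ + p₂₃) / 2 ∧
      |(b 0 * x 0 + b 1 * x 1 + b 2 * x 2) + (c 0 * x 0 + c 1 * x 1 + c 2 * x 2)| ≤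
        (p₀₂ + p₀₃ + p₁₂ + p₁₃) / 2)
    (hspan : ∀ x : E3, ∃ r s t : ℝ, ∀ i, x i = r * a i + s * b i + t * c i)
    (hp : 0 ≤ p₀₁ ∧ 0 ≤ p₀₂ ∧ 0 ≤ p₀₃ ∧ 0 ≤ p₁₂ ∧ 0 ≤ p₁₃ ∧ 0 ≤ p₂₃)
    (h₀₁ : B.rootProduct (σ 0) (σ 1) = 0 ↔ p₀₁ = 0)
    (h₀₂ : B.rootProduct (σ 0) (σ 2) = 0 ↔ p₀₂ = 0)
    (h₀₃ : B.rootProduct (σ 0) (σ 3) = 0 ↔ p₀₃ = 0)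
    (h₁₂ : B.rootProduct (σ 1) (σ 2) = 0 ↔ p₁₂ = 0)
    (h₁₃ : B.rootProduct (σ 1) (σ 3) = 0 ↔ p₁₃ = 0)
    (h₂₃ : B.rootProduct (σ 2) (σ 3) = 0 ↔ p₂₃ = 0) :
    HasVoronoiType B.lattice T := by
  have hne : ∀ {i j : Fin 4}, i ≠ j → σ i ≠ σ j := fun h => σ.injective.ne h
  have hu0 : ∑ i, B.v (σ i) = 0 := by rw [Equiv.sum_comp σ]; exact B.sum_v
  have hP : T.polytope =
      graphZonotope (superbaseOfCoords a b c) (edgeWeights p₀₁ p₀₂ p₀₃ p₁₂ p₁₃ p₂₃) := by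
    ext x
    rw [hT, mem_graphZonotope_edgeWeights (sum_superbaseOfCoords a b c) (inner_toLp a x)
      (inner_toLp b x) (inner_toLp c x)]
  have hV := voronoiDomain_eq_graphZonotope (u := fun i => B.v (σ i)) hu0
    (fun i j h => B.obtuse _ _ (hne h)) (Λ := B.lattice) (fun x => by
      rw [B.mem_lattice_iff']
      constructor
      · rintro ⟨n, rfl⟩
        exact ⟨n ∘ σ, (Equiv.sum_comp σ fun i => (n i : ℝ) • B.v i).symm⟩
      · rintro ⟨n, rfl⟩
        exact ⟨n ∘ σ.symm, by
          rw [← Equiv.sum_comp σ fun i => ((n ∘ σ.symm) i : ℝ) • B.v i]; simp⟩)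
  rw [HasVoronoiType, hP, hV]
  obtain ⟨q1, q2, q3, q4, q5, q6⟩ := hp
  refine combinatoriallyEquivalent_graphZonotope hu0 ?_ (fun i j => B.conorm_comm (σ i) (σ j))
    (fun i j h => B.obtuse _ _ (hne h)) (sum_superbaseOfCoords a b c) ?_ ?_ ?_ ?_
  · intro x
    obtain ⟨n, rfl⟩ := B.exists_eq_sum_smul x
    exact ⟨n ∘ σ, (Equiv.sum_comp σ fun i => n i • B.v i).symm⟩
  · intro x
    obtain ⟨r, s, t, h⟩ := hspan x
    refine ⟨![0, r, s, t], ?_⟩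
    ext i
    simp [superbaseOfCoords, Fin.sum_univ_four, h]
  · intro i j
    fin_cases i <;> fin_cases j <;> rfl
  · intro i j hij
    fin_cases i <;> fin_cases j <;> first | exact absurd rfl hij | simpa [edgeWeights]
  · intro i j hij
    change B.conorm (σ i) (σ j) = 0 ↔ _
    rw [← B.rootProduct_eq_zero_iff (hne hij)]
    fin_cases i <;> fin_cases j <;> first
      | exact absurd rfl hij
      | simpa [edgeWeights]
      | (rw [B.rootProduct_comm]; simpa [edgeWeights])

theorem abs_add_abs_le_iff (a b c : ℝ) : |a| + |b| ≤ c ↔ |a + b| ≤ c ∧ |a - b| ≤ c := by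
  constructor
  · exact fun h => ⟨(abs_add_le a b).trans h, (abs_sub a b).trans h⟩
  · rintro ⟨h1, h2⟩
    rw [abs_le] at h1 h2
    rcases abs_cases a with ⟨h, -⟩ | ⟨h, -⟩ <;> rcases abs_cases b with ⟨h', -⟩ | ⟨h', -⟩ <;>
      rw [h, h'] <;> linarith

/-- In this and the following cases, vectors and weights are chosen so that the graphical zonotope
equals the reference polytope as a set, with weights vanishing in the prescribed positions. -/
theorem hasVoronoiType_V1 {B : ObtuseSuperbase} {σ : Equiv.Perm (Fin 4)}
    (h01 : B.rootProduct (σ 0) (σ 1) ≠ 0) (h02 : B.rootProduct (σ 0) (σ 2) ≠ 0)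
    (h03 : B.rootProduct (σ 0) (σ 3) ≠ 0) (h12 : B.rootProduct (σ 1) (σ 2) ≠ 0)
    (h13 : B.rootProduct (σ 1) (σ 3) ≠ 0) (h23 : B.rootProduct (σ 2) (σ 3) ≠ 0) :
    HasVoronoiType B.lattice .V1 := by
  refine hasVoronoiType_of_polytope_eq B σ (a := ![1 / 2, 1 / 2, -1 / 2])
    (b := ![1 / 2, -1 / 2, 1 / 2]) (c := ![-1 / 2, 1 / 2, 1 / 2])
    (p₀₁ := 1) (p₀₂ := 1) (p₀₃ := 1) (p₁₂ := 1) (p₁₃ := 1) (p₂₃ := 1)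
    (fun x => ?_) (fun x => ?_) (by norm_num) (by simpa) (by simpa) (by simpa) (by simpa)
    (by simpa) (by simpa)
  · simp only [VoronoiType.polytope, Set.mem_ofPred_eq, Matrix.cons_val]
    have h3 : |x 0| + |x 1| + |x 2| ≤ 3 ↔ |x 0 + x 1 + x 2| ≤ 3 ∧ |x 0 + x 1 - x 2| ≤ 3 ∧
        |x 0 - x 1 + x 2| ≤ 3 ∧ |x 0 - x 1 - x 2| ≤ 3 := by
      rw [← le_sub_iff_add_le, abs_add_abs_le_iff, le_sub_iff_add_le, le_sub_iff_add_le,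
        abs_add_abs_le_iff, abs_add_abs_le_iff, and_assoc]
    simp only [h3, abs_le]
    constructor
    · intro h
      and_intros <;> linarith
    · intro h
      and_intros <;> linarith
  · exact ⟨x 0 + x 1, x 0 + x 2, x 1 + x 2, fun i => by fin_cases i <;> simp <;> ring⟩

theorem hasVoronoiType_V2 {B : ObtuseSuperbase} {σ : Equiv.Perm (Fin 4)}
    (h01 : B.rootProduct (σ 0) (σ 1) ≠ 0) (h02 : B.rootProduct (σ 0) (σ 2) ≠ 0)
    (h03 : B.rootProduct (σ 0) (σ 3) ≠ 0) (h12 : B.rootProduct (σ 1) (σ 2) ≠ 0)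
    (h13 : B.rootProduct (σ 1) (σ 3) ≠ 0) (h23 : B.rootProduct (σ 2) (σ 3) = 0) :
    HasVoronoiType B.lattice .V2 := by
  refine hasVoronoiType_of_polytope_eq B σ (a := ![0, 1, 1]) (b := ![1, -1, 0]) (c := ![-1, -1, 0])
    (p₀₁ := 2) (p₀₂ := 2) (p₀₃ := 2) (p₁₂ := 2) (p₁₃ := 2) (p₂₃ := 0)
    (fun x => ?_) (fun x => ?_) (by norm_num) (by simpa) (by simpa) (by simpa) (by simpa)
    (by simpa) (by simpa)
  · simp only [VoronoiType.polytope, Set.mem_ofPred_eq, Matrix.cons_val]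
    simp only [abs_add_abs_le_iff, abs_le]
    constructor
    · intro h
      and_intros <;> linarith
    · intro h
      and_intros <;> linarith
  · exact ⟨x 2, (x 0 - x 1 + x 2) / 2, (x 2 - x 1 - x 0) / 2,
      fun i => by fin_cases i <;> simp <;> ring⟩

theorem hasVoronoiType_V3 {B : ObtuseSuperbase} {σ : Equiv.Perm (Fin 4)}
    (h01 : B.rootProduct (σ 0) (σ 1) = 0) (h02 : B.rootProduct (σ 0) (σ 2) ≠ 0)
    (h03 : B.rootProduct (σ 0) (σ 3) ≠ 0) (h12 : B.rootProduct (σ 1) (σ 2) ≠ 0)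
    (h13 : B.rootProduct (σ 1) (σ 3) ≠ 0) (h23 : B.rootProduct (σ 2) (σ 3) = 0) :
    HasVoronoiType B.lattice .V3 := by
  refine hasVoronoiType_of_polytope_eq B σ (a := ![1, 1, 0]) (b := ![0, -1, 1]) (c := ![0, -1, -1])
    (p₀₁ := 0) (p₀₂ := 2) (p₀₃ := 2) (p₁₂ := 2) (p₁₃ := 2) (p₂₃ := 0)
    (fun x => ?_) (fun x => ?_) (by norm_num) (by simpa) (by simpa) (by simpa) (by simpa)
    (by simpa) (by simpa)
  · simp only [VoronoiType.polytope, Set.mem_ofPred_eq, Matrix.cons_val]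
    simp only [abs_add_abs_le_iff, abs_le]
    constructor
    · intro h
      and_intros <;> linarith
    · intro h
      and_intros <;> linarith
  · exact ⟨x 0, (x 2 - x 1 + x 0) / 2, (x 0 - x 1 - x 2) / 2,
      fun i => by fin_cases i <;> simp <;> ring⟩

theorem hasVoronoiType_V4 {B : ObtuseSuperbase} {σ : Equiv.Perm (Fin 4)}
    (h01 : B.rootProduct (σ 0) (σ 1) ≠ 0) (h02 : B.rootProduct (σ 0) (σ 2) ≠ 0)
    (h03 : B.rootProduct (σ 0) (σ 3) ≠ 0) (h12 : B.rootProduct (σ 1) (σ 2) ≠ 0)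
    (h13 : B.rootProduct (σ 1) (σ 3) = 0) (h23 : B.rootProduct (σ 2) (σ 3) = 0) :
    HasVoronoiType B.lattice .V4 := by
  refine hasVoronoiType_of_polytope_eq B σ (a := ![1, 0, 0]) (b := ![0, -1, 0]) (c := ![0, 0, 1])
    (p₀₁ := 1) (p₀₂ := 1) (p₀₃ := 2) (p₁₂ := 1) (p₁₃ := 0) (p₂₃ := 0)
    (fun x => ?_) (fun x => ?_) (by norm_num) (by simpa) (by simpa) (by simpa) (by simpa)
    (by simpa) (by simpa)
  · simp only [VoronoiType.polytope, Set.mem_ofPred_eq, Matrix.cons_val]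
    simp only [abs_le]
    constructor
    · intro h
      and_intros <;> linarith
    · intro h
      and_intros <;> linarith
  · exact ⟨x 0, -x 1, x 2, fun i => by fin_cases i <;> simp⟩

/-- The trees on four vertices are the star and the path; both yield the cube. -/
theorem hasVoronoiType_V5_star {B : ObtuseSuperbase} {σ : Equiv.Perm (Fin 4)}
    (h01 : B.rootProduct (σ 0) (σ 1) ≠ 0) (h02 : B.rootProduct (σ 0) (σ 2) ≠ 0)
    (h03 : B.rootProduct (σ 0) (σ 3) ≠ 0) (h12 : B.rootProduct (σ 1) (σ 2) = 0)
    (h13 : B.rootProduct (σ 1) (σ 3) = 0) (h23 : B.rootProduct (σ 2) (σ 3) = 0) :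
    HasVoronoiType B.lattice .V5 := by
  refine hasVoronoiType_of_polytope_eq B σ (a := ![1, 0, 0]) (b := ![0, 1, 0]) (c := ![0, 0, 1])
    (p₀₁ := 2) (p₀₂ := 2) (p₀₃ := 2) (p₁₂ := 0) (p₁₃ := 0) (p₂₃ := 0)
    (fun x => ?_) (fun x => ?_) (by norm_num) (by simpa) (by simpa) (by simpa) (by simpa)
    (by simpa) (by simpa)
  · simp only [VoronoiType.polytope, Set.mem_ofPred_eq, Matrix.cons_val]
    simp only [abs_le]
    constructor
    · intro h
      and_intros <;> linarith
    · intro h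
      and_intros <;> linarith
  · exact ⟨x 0, x 1, x 2, fun i => by fin_cases i <;> simp⟩

theorem hasVoronoiType_V5_path {B : ObtuseSuperbase} {σ : Equiv.Perm (Fin 4)}
    (h01 : B.rootProduct (σ 0) (σ 1) = 0) (h02 : B.rootProduct (σ 0) (σ 2) ≠ 0)
    (h03 : B.rootProduct (σ 0) (σ 3) ≠ 0) (h12 : B.rootProduct (σ 1) (σ 2) ≠ 0)
    (h13 : B.rootProduct (σ 1) (σ 3) = 0) (h23 : B.rootProduct (σ 2) (σ 3) = 0) :
    HasVoronoiType B.lattice .V5 := by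
  refine hasVoronoiType_of_polytope_eq B σ (a := ![1, 0, 0]) (b := ![-1, 1, 0]) (c := ![0, 0, 1])
    (p₀₁ := 0) (p₀₂ := 2) (p₀₃ := 2) (p₁₂ := 2) (p₁₃ := 0) (p₂₃ := 0)
    (fun x => ?_) (fun x => ?_) (by norm_num) (by simpa) (by simpa) (by simpa) (by simpa)
    (by simpa) (by simpa)
  · simp only [VoronoiType.polytope, Set.mem_ofPred_eq, Matrix.cons_val]
    simp only [abs_le]
    constructor
    · intro h
      and_intros <;> linarith
    · intro h
      and_intros <;> linarith
  · exact ⟨x 0 + x 1, x 1, x 2, fun i => by fin_cases i <;> simp⟩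

/-- The positions of the vanishing root products determine the Voronoi type. -/
theorem hasVoronoiType_of_orderedRootForm {B : ObtuseSuperbase} {σ : Equiv.Perm (Fin 4)}
    {L : List ℝ} {T : VoronoiType}
    (h : OrderedRootForm (fun i j => B.rootProduct (σ i) (σ j)) L T) :
    HasVoronoiType B.lattice T := by
  cases T with
  | V1 =>
    obtain ⟨⟨h23, h13, h12, h01, h02, h03⟩, -⟩ := h
    exact hasVoronoiType_V1 h01 h02 h03 h12 h13 h23
  | V2 =>
    obtain ⟨⟨h23, h13, h12, h01, h02, h03⟩, -⟩ := h
    exact hasVoronoiType_V2 h01 h02 h03 h12 h13 h23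
  | V3 =>
    obtain ⟨⟨h23, h01, h13, h12, h02, h03⟩, -⟩ := h
    exact hasVoronoiType_V3 h01 h02 h03 h12 h13 h23
  | V4 =>
    obtain ⟨⟨h23, h13, h12, h01, h02, h03⟩, -⟩ := h
    exact hasVoronoiType_V4 h01 h02 h03 h12 h13 h23
  | V5 =>
    rcases h with ⟨⟨h23, h13, h12, h01, h02, h03⟩, -⟩ | ⟨⟨h23, h13, h01, h12, h02, h03⟩, -⟩
    · exact hasVoronoiType_V5_star h01 h02 h03 h12 h13 h23
    · exact hasVoronoiType_V5_path h01 h02 h03 h12 h13 h23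

/-- From here on, geometry is gone: arrangements are a matter of six numbers on the edges of a
graph. -/
theorem isRootArrangement_iff {B : ObtuseSuperbase} {R : RootInvariant} :
    IsRootArrangement B R ↔ ∃ σ : Equiv.Perm (Fin 4),
      OrderedRootForm (fun i j => B.rootProduct (σ i) (σ j)) R.entries R.type :=
  ⟨fun h => h.2, fun ⟨σ, h⟩ => ⟨hasVoronoiType_of_orderedRootForm h, σ, h⟩⟩

end ReferencePolytopes

/-! ### Existence, finiteness and lexicographic uniqueness of root forms. -/

section RootForms

theorem List.cons_le_cons_iff_lex {a b : ℝ} {l l' : List ℝ} :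
    a :: l ≤ b :: l' ↔ a < b ∨ a = b ∧ l ≤ l' := by
  rw [← not_lt, List.cons_lt_cons_iff, ← not_lt]
  rcases lt_trichotomy a b with h | h | h
  · simp [h, h.not_gt, h.ne']
  · simp [h]
  · simp [h, h.not_gt, h.ne']

/-- The entries of `R` are the `r i j`, ordered by the rules for the type of `R` after an
index-permutation. -/
def HasRootForm (r : Fin 4 → Fin 4 → ℝ) (R : RootInvariant) : Prop :=
  ∃ σ : Equiv.Perm (Fin 4), OrderedRootForm (fun i j => r (σ i) (σ j)) R.entries R.type

theorem exists_isIncreasingOrderOf (L : List ℝ) : ∃ L', IsIncreasingOrderOf L' L :=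
  ⟨L.insertionSort (· ≤ ·), List.perm_insertionSort _ _, List.pairwise_insertionSort _ _⟩

theorem D4Related.trans {M N K : Matrix (Fin 2) (Fin 2) ℝ} (h : D4Related M N)
    (h' : D4Related N K) : D4Related M K := by
  obtain ⟨α, β, h⟩ := h
  obtain ⟨γ, δ, h'⟩ := h'
  rcases h with rfl | rfl <;> rcases h' with rfl | rfl
  · exact ⟨α * γ, β * δ, Or.inl rfl⟩
  · exact ⟨β * γ, α * δ, Or.inr rfl⟩
  · exact ⟨α * γ, β * δ, Or.inr rfl⟩
  · exact ⟨β * γ, α * δ, Or.inl rfl⟩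

theorem D4Related.exists_apply_eq {M A : Matrix (Fin 2) (Fin 2) ℝ} (h : D4Related M A)
    (i j : Fin 2) : ∃ k l, A i j = M k l := by
  obtain ⟨α, β, rfl | rfl⟩ := h
  · exact ⟨_, _, rfl⟩
  · exact ⟨_, _, rfl⟩

/-- Row and column swaps bring a minimal entry to the corner; a transposition then orders its two
neighbours. -/
theorem exists_d4Related_ordered (M : Matrix (Fin 2) (Fin 2) ℝ) : ∃ A, D4Related M A ∧
    A 0 0 ≤ A 0 1 ∧ A 0 0 ≤ A 1 0 ∧ A 0 0 ≤ A 1 1 ∧ A 0 1 ≤ A 1 0 := by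
  obtain ⟨⟨i, j⟩, hij⟩ := Finite.exists_min fun k : Fin 2 × Fin 2 => M k.1 k.2
  have h : ∀ k l, M (Equiv.swap 0 i 0) (Equiv.swap 0 j 0) ≤ M k l := fun k l => by
    simpa using hij (k, l)
  rcases le_total (M.submatrix (Equiv.swap 0 i) (Equiv.swap 0 j) 0 1)
    (M.submatrix (Equiv.swap 0 i) (Equiv.swap 0 j) 1 0) with h' | h'
  · exact ⟨M.submatrix (Equiv.swap 0 i) (Equiv.swap 0 j), ⟨_, _, Or.inl rfl⟩,
      h _ _, h _ _, h _ _, h'⟩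
  · exact ⟨M.transpose.submatrix (Equiv.swap 0 j) (Equiv.swap 0 i), ⟨_, _, Or.inr rfl⟩,
      h _ _, h _ _, h _ _, h'⟩

/-- All lists have length at most six and entries among the sixteen values of `r`, so a
lexicographic minimum exists. -/
theorem finite_entries (r : Fin 4 → Fin 4 → ℝ) :
    {L | ∃ R, HasRootForm r R ∧ R.entries = L}.Finite := by
  refine ((List.finite_length_le (Fin 4 × Fin 4) 6).image
    (List.map fun e => r e.1 e.2)).subset ?_
  rintro L ⟨⟨T, L⟩, ⟨σ, h⟩, rfl⟩
  suffices hL : L.length ≤ 6 ∧ ∀ x ∈ L, ∃ i j, x = r (σ i) (σ j) by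
    have : L ∈ Set.range (List.map fun e : Fin 4 × Fin 4 => r e.1 e.2) := by
      rw [Set.range_list_map]
      intro x hx
      obtain ⟨i, j, rfl⟩ := hL.2 x hx
      exact ⟨(σ i, σ j), rfl⟩
    obtain ⟨l, rfl⟩ := this
    exact ⟨l, by simpa using hL.1, rfl⟩
  have hmem : ∀ {L' L : List ℝ}, IsIncreasingOrderOf L' L →
      (∀ x ∈ L, ∃ i j, x = r (σ i) (σ j)) → ∀ x ∈ L', ∃ i j, x = r (σ i) (σ j) :=
    fun h h' x hx => h' x (h.1.mem_iff.1 hx)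
  cases T with
  | V1 =>
    obtain ⟨-, -, -, -, -, rfl⟩ := h
    refine ⟨by simp, ?_⟩
    simp only [List.forall_mem_cons, List.not_mem_nil, false_imp_iff, implies_true, and_true]
    exact ⟨⟨_, _, rfl⟩, ⟨_, _, rfl⟩, ⟨_, _, rfl⟩, ⟨_, _, rfl⟩, ⟨_, _, rfl⟩, ⟨_, _, rfl⟩⟩
  | V2 =>
    obtain ⟨-, A, hA, -, -, -, -, rfl⟩ := h
    have hA' : ∀ k l, ∃ i j, A k l = r (σ i) (σ j) := by
      intro k l
      obtain ⟨k', l', h⟩ := hA.exists_apply_eq k l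
      rw [h]
      fin_cases k' <;> fin_cases l' <;> exact ⟨_, _, rfl⟩
    refine ⟨by simp, ?_⟩
    simp only [List.forall_mem_cons, List.not_mem_nil, false_imp_iff, implies_true, and_true]
    exact ⟨⟨_, _, rfl⟩, hA' _ _, hA' _ _, hA' _ _, hA' _ _⟩
  | V3 =>
    obtain ⟨-, h⟩ := h
    refine ⟨by rw [h.1.length_eq]; simp, hmem h ?_⟩
    simp only [List.forall_mem_cons, List.not_mem_nil, false_imp_iff, implies_true, and_true]
    exact ⟨⟨_, _, rfl⟩, ⟨_, _, rfl⟩, ⟨_, _, rfl⟩, ⟨_, _, rfl⟩⟩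
  | V4 =>
    obtain ⟨-, L₃, h, rfl⟩ := h
    refine ⟨by simp [h.1.length_eq], ?_⟩
    rw [List.forall_mem_append]
    refine ⟨hmem h ?_, ?_⟩ <;>
      simp only [List.forall_mem_cons, List.not_mem_nil, false_imp_iff, implies_true, and_true]
    · exact ⟨⟨_, _, rfl⟩, ⟨_, _, rfl⟩, ⟨_, _, rfl⟩⟩
    · exact ⟨_, _, rfl⟩
  | V5 =>
    rcases h with ⟨-, h⟩ | ⟨-, h⟩ <;>
    · refine ⟨by rw [h.1.length_eq]; simp, hmem h ?_⟩
      simp only [List.forall_mem_cons, List.not_mem_nil, false_imp_iff, implies_true, and_true]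
      exact ⟨⟨_, _, rfl⟩, ⟨_, _, rfl⟩, ⟨_, _, rfl⟩⟩

/-- The two zeros lie on disjoint edges for `V3` and on edges with a common vertex for `V4`. -/
theorem not_V3_and_V4 {r : Fin 4 → Fin 4 → ℝ} (hr : ∀ i j, r i j = r j i) {L L' : List ℝ}
    (h : HasRootForm r ⟨.V3, L⟩) (h' : HasRootForm r ⟨.V4, L'⟩) : False := by
  obtain ⟨σ, ⟨-, -, h13, h12, h02, h03⟩, -⟩ := h
  obtain ⟨τ, ⟨h23', h13', -⟩, -⟩ := h'
  have key : ∀ i j k : Fin 4, i ≠ j → i ≠ k → j ≠ k → r (σ i) (σ j) = 0 → r (σ i) (σ k) ≠ 0 := by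
    intro i j k hij hik hjk
    fin_cases i <;> fin_cases j <;> fin_cases k <;> first
      | exact absurd rfl hij | exact absurd rfl hik | exact absurd rfl hjk
      | exact fun _ => h13 | exact fun _ => h12 | exact fun _ => h02 | exact fun _ => h03
      | (rw [hr _ (σ _)]; exact fun h => absurd h (by assumption))
      | exact fun h => absurd h (by assumption)
      | (intro _; rw [hr]; assumption)
  have hne : ∀ {a b : Fin 4}, a ≠ b → σ.symm (τ a) ≠ σ.symm (τ b) :=
    fun h => σ.symm.injective.ne (τ.injective.ne h)
  refine key (σ.symm (τ 3)) (σ.symm (τ 2)) (σ.symm (τ 1)) (hne (by decide)) (hne (by decide))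
    (hne (by decide)) ?_ ?_
  · rw [Equiv.apply_symm_apply, Equiv.apply_symm_apply, hr]; exact h23'
  · rw [Equiv.apply_symm_apply, Equiv.apply_symm_apply, hr]; exact h13'

/-- The length of the list separates all types except `V3` and `V4`, whose zero patterns exclude
each other. Minimality of the entries alone therefore fixes the type as well. -/
theorem HasRootForm.ext {r : Fin 4 → Fin 4 → ℝ} (hr : ∀ i j, r i j = r j i)
    {R R' : RootInvariant} (h : HasRootForm r R) (h' : HasRootForm r R')
    (hL : R.entries = R'.entries) : R = R' := by
  have hlen : ∀ {R}, HasRootForm r R → R.entries.length =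
      match R.type with | .V1 => 6 | .V2 => 5 | .V3 => 4 | .V4 => 4 | .V5 => 3 := by
    rintro ⟨T, L⟩ ⟨σ, h⟩
    cases T with
    | V1 => obtain ⟨-, -, -, -, -, rfl⟩ := h; rfl
    | V2 => obtain ⟨-, A, hA, -, -, -, -, rfl⟩ := h; rfl
    | V3 => exact h.2.1.length_eq
    | V4 => obtain ⟨-, L₃, h, rfl⟩ := h; simp [h.1.length_eq]
    | V5 => rcases h with ⟨-, h⟩ | ⟨-, h⟩ <;> exact h.1.length_eq
  refine RootInvariant.ext ?_ hL
  have e := hlen h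
  rw [hL, hlen h'] at e
  obtain ⟨T, L⟩ := R
  obtain ⟨T', L'⟩ := R'
  cases T <;> cases T' <;> first
    | rfl
    | exact (not_V3_and_V4 hr h h').elim
    | exact (not_V3_and_V4 hr h' h).elim
    | exact absurd e (by simp)

/-- The lexicographically smallest of the 24 relabelled lists satisfies every `V1` condition. -/
theorem exists_V1_form {r : Fin 4 → Fin 4 → ℝ} (hr : ∀ i j, r i j = r j i)
    (h0 : ∀ i j, i ≠ j → r i j ≠ 0) : ∃ R, HasRootForm r R := by
  obtain ⟨σ, hσ⟩ := Finite.exists_min fun σ : Equiv.Perm (Fin 4) =>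
    [r (σ 2) (σ 3), r (σ 1) (σ 3), r (σ 1) (σ 2), r (σ 0) (σ 1), r (σ 0) (σ 2), r (σ 0) (σ 3)]
  have hne : ∀ {a b : Fin 4}, a ≠ b → r (σ a) (σ b) ≠ 0 := fun h => h0 _ _ (σ.injective.ne h)
  have key := fun τ : Equiv.Perm (Fin 4) => hσ (σ * τ)
  simp only [List.cons_le_cons_iff_lex, Equiv.Perm.mul_apply] at key
  -- The relabellings `t1`, `t3`, `t4`, `t5`, `t6` bring each of the other five entries to the
  -- front; `t2`, `t7`, `t8` keep the first entry and bring each competitor to second place. The tie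
  -- rules come from `t1` and `t2`.
  have t1 := key (Equiv.swap 1 2)
  have t2 := key (Equiv.swap 2 3)
  have t3 := key (Equiv.swap 1 3)
  have t4 := key (Equiv.swap 0 2 * Equiv.swap 1 3)
  have t5 := key (Equiv.swap 0 3)
  have t6 := key (Equiv.swap 0 2)
  have t7 := key (Equiv.swap 0 1 * Equiv.swap 2 3)
  have t8 := key (Equiv.swap 0 1)
  have e : ∀ i j k : Fin 4, Equiv.swap i j k = if k = i then j else if k = j then i else k :=
    fun i j k => Equiv.swap_apply_def i j k
  simp only [Equiv.Perm.mul_apply, e, Fin.isValue, Fin.reduceEq, if_true, if_false,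
    hr (σ 1) (σ 0), hr (σ 2) (σ 0), hr (σ 3) (σ 0), hr (σ 2) (σ 1), hr (σ 3) (σ 1),
    hr (σ 3) (σ 2)] at t1 t2 t3 t4 t5 t6 t7 t8
  clear key hσ
  refine ⟨⟨.V1, _⟩, σ, ⟨hne (by decide), hne (by decide), hne (by decide), hne (by decide),
    hne (by decide), hne (by decide)⟩, ?_, ?_, ?_, ?_, rfl⟩
  · refine ⟨?_, ?_, ?_, ?_, ?_⟩ <;> grind
  · refine ⟨?_, ?_, ?_⟩ <;> grind
  · grind
  · grind

/-- The values of a symmetric function on the edges of a complete graph on four vertices. -/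
def edgeFlags (z₀₁ z₀₂ z₀₃ z₁₂ z₁₃ z₂₃ : Bool) (i j : Fin 4) : Bool :=
  match i, j with
  | 0, 1 => z₀₁ | 0, 2 => z₀₂ | 0, 3 => z₀₃ | 1, 2 => z₁₂ | 1, 3 => z₁₃ | 2, 3 => z₂₃
  | 1, 0 => z₀₁ | 2, 0 => z₀₂ | 3, 0 => z₀₃ | 2, 1 => z₁₂ | 3, 1 => z₁₃ | 3, 2 => z₂₃
  | _, _ => false

/-- The connected graphs on four vertices. -/
theorem exists_relabelling_of_connected : ∀ a b c d e f : Bool,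
    (a || b || c) → (a || d || e) → (b || d || f) → (c || e || f) →
    (b || c || d || e) → (a || c || d || f) → (a || b || e || f) →
    ∃ w x y z : Fin 4, (w ≠ x ∧ w ≠ y ∧ w ≠ z ∧ x ≠ y ∧ x ≠ z ∧ y ≠ z) ∧
      [edgeFlags a b c d e f y z, edgeFlags a b c d e f x z, edgeFlags a b c d e f x y,
        edgeFlags a b c d e f w x, edgeFlags a b c d e f w y, edgeFlags a b c d e f w z] ∈
      ([[true, true, true, true, true, true], [false, true, true, true, true, true],
        [false, true, true, false, true, true], [false, false, true, true, true, true],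
        [false, false, false, true, true, true], [false, false, true, false, true, true]] :
        List (List Bool)) := by
  decide +kernel

theorem vec_injective {w x y t : Fin 4} (h1 : w ≠ x) (h2 : w ≠ y) (h3 : w ≠ t) (h4 : x ≠ y)
    (h5 : x ≠ t) (h6 : y ≠ t) : Function.Injective ![w, x, y, t] := by
  intro i j hij
  fin_cases i <;> fin_cases j <;> first
    | rfl
    | exact absurd hij h1 | exact absurd hij h2 | exact absurd hij h3
    | exact absurd hij h4 | exact absurd hij h5 | exact absurd hij h6
    | exact absurd hij.symm h1 | exact absurd hij.symm h2 | exact absurd hij.symm h3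
    | exact absurd hij.symm h4 | exact absurd hij.symm h5 | exact absurd hij.symm h6

/-- The graph of non-zero root products is connected. -/
def EdgesConnected (r : Fin 4 → Fin 4 → ℝ) : Prop :=
  ∀ S : Finset (Fin 4), S.Nonempty → Sᶜ.Nonempty → ∃ i ∈ S, ∃ j ∈ Sᶜ, r i j ≠ 0

/-- Up to relabelling the support is the complete graph, that graph minus an edge, a 4-cycle, a
triangle with a pendant edge, a star or a path, in the order of the final cases. -/
theorem exists_hasRootForm {r : Fin 4 → Fin 4 → ℝ} (hr : ∀ i j, r i j = r j i)
    (hc : EdgesConnected r) : ∃ R, HasRootForm r R := by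
  classical
  set z : Fin 4 → Fin 4 → Bool := fun i j => decide (r i j ≠ 0) with hz
  have hzc : ∀ i j, z j i = z i j := fun i j => by simp only [hz, hr]
  have hzr : ∀ i j, i ≠ j → edgeFlags (z 0 1) (z 0 2) (z 0 3) (z 1 2) (z 1 3) (z 2 3) i j =
      z i j := by
    intro i j h
    fin_cases i <;> fin_cases j <;> first | exact absurd rfl h | rfl | exact hzc _ _
  have hS : ∀ S : Finset (Fin 4), S.Nonempty → Sᶜ.Nonempty → ∃ i ∈ S, ∃ j ∈ Sᶜ, z i j = true := by
    intro S h h'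
    obtain ⟨i, hi, j, hj, hij⟩ := hc S h h'
    exact ⟨i, hi, j, hj, by simpa [hz] using hij⟩
  have e0 : ({0} : Finset (Fin 4))ᶜ = {1, 2, 3} := by decide
  have e1 : ({1} : Finset (Fin 4))ᶜ = {0, 2, 3} := by decide
  have e2 : ({2} : Finset (Fin 4))ᶜ = {0, 1, 3} := by decide
  have e3 : ({3} : Finset (Fin 4))ᶜ = {0, 1, 2} := by decide
  have e4 : ({0, 1} : Finset (Fin 4))ᶜ = {2, 3} := by decide
  have e5 : ({0, 2} : Finset (Fin 4))ᶜ = {1, 3} := by decide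
  have e6 : ({0, 3} : Finset (Fin 4))ᶜ = {1, 2} := by decide
  have s0 := hS {0} (by decide) (by decide)
  have s1 := hS {1} (by decide) (by decide)
  have s2 := hS {2} (by decide) (by decide)
  have s3 := hS {3} (by decide) (by decide)
  have s4 := hS {0, 1} (by decide) (by decide)
  have s5 := hS {0, 2} (by decide) (by decide)
  have s6 := hS {0, 3} (by decide) (by decide)
  rw [e0] at s0
  rw [e1] at s1
  rw [e2] at s2
  rw [e3] at s3
  rw [e4] at s4
  rw [e5] at s5
  rw [e6] at s6
  simp only [Finset.mem_insert, Finset.mem_singleton, exists_eq_or_imp, exists_eq_left,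
    hzc 0 1, hzc 0 2, hzc 0 3, hzc 1 2, hzc 1 3, hzc 2 3] at s0 s1 s2 s3 s4 s5 s6
  obtain ⟨w, x, y, t, ⟨h1, h2, h3, h4, h5, h6⟩, hl⟩ := exists_relabelling_of_connected
    (z 0 1) (z 0 2) (z 0 3) (z 1 2) (z 1 3) (z 2 3)
    (by simpa only [Bool.or_eq_true, or_assoc] using s0)
    (by simpa only [Bool.or_eq_true, or_assoc] using s1)
    (by simpa only [Bool.or_eq_true, or_assoc] using s2)
    (by simpa only [Bool.or_eq_true, or_assoc] using s3)
    (by simpa only [Bool.or_eq_true, or_assoc] using s4)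
    (by simpa only [Bool.or_eq_true, or_assoc] using s5)
    (by simpa only [Bool.or_eq_true, or_assoc] using s6)
  rw [hzr _ _ h1, hzr _ _ h2, hzr _ _ h3, hzr _ _ h4, hzr _ _ h5, hzr _ _ h6] at hl
  have hinj : Function.Injective ![w, x, y, t] := vec_injective h1 h2 h3 h4 h5 h6
  set σ : Equiv.Perm (Fin 4) := Equiv.ofBijective _ (Finite.injective_iff_bijective.1 hinj) with hσ
  have σ0 : σ 0 = w := rfl
  have σ1 : σ 1 = x := rfl
  have σ2 : σ 2 = y := rfl
  have σ3 : σ 3 = t := rfl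
  simp only [List.mem_cons, List.not_mem_nil, or_false, List.cons.injEq, and_true, hz,
    decide_eq_true_eq, decide_eq_false_iff_not, not_not, ← σ0, ← σ1, ← σ2, ← σ3] at hl
  rcases hl with ⟨h23, h13, h12, h01, h02, h03⟩ | hl | hl | hl | hl | hl
  · refine exists_V1_form hr fun i j hij => ?_
    rw [← σ.apply_symm_apply i, ← σ.apply_symm_apply j]
    have hne : σ.symm i ≠ σ.symm j := σ.symm.injective.ne hij
    generalize σ.symm i = i' at *
    generalize σ.symm j = j' at *
    clear_value σ
    fin_cases i' <;> fin_cases j' <;> first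
      | exact absurd rfl hne | assumption | (rw [hr]; assumption)
  · obtain ⟨A, hA, h1, h2, h3, h4⟩ := exists_d4Related_ordered
      !![r (σ 1) (σ 3), r (σ 1) (σ 2); r (σ 0) (σ 2), r (σ 0) (σ 3)]
    exact ⟨⟨.V2, _⟩, σ, hl, A, hA, h1, h2, h3, h4, rfl⟩
  · obtain ⟨L, hL⟩ := exists_isIncreasingOrderOf
      [r (σ 1) (σ 3), r (σ 1) (σ 2), r (σ 0) (σ 2), r (σ 0) (σ 3)]
    obtain ⟨h23, h13, h12, h01, h02, h03⟩ := hl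
    exact ⟨⟨.V3, L⟩, σ, ⟨h23, h01, h13, h12, h02, h03⟩, hL⟩
  · obtain ⟨L, hL⟩ := exists_isIncreasingOrderOf [r (σ 1) (σ 2), r (σ 0) (σ 1), r (σ 0) (σ 2)]
    exact ⟨⟨.V4, _⟩, σ, hl, L, hL, rfl⟩
  · obtain ⟨L, hL⟩ := exists_isIncreasingOrderOf [r (σ 0) (σ 1), r (σ 0) (σ 2), r (σ 0) (σ 3)]
    exact ⟨⟨.V5, L⟩, σ, Or.inl ⟨hl, hL⟩⟩
  · obtain ⟨L, hL⟩ := exists_isIncreasingOrderOf [r (σ 1) (σ 2), r (σ 0) (σ 2), r (σ 0) (σ 3)]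
    obtain ⟨h23, h13, h12, h01, h02, h03⟩ := hl
    exact ⟨⟨.V5, L⟩, σ, Or.inr ⟨⟨h23, h13, h01, h12, h02, h03⟩, hL⟩⟩

theorem existsUnique_minimal_rootForm {r : Fin 4 → Fin 4 → ℝ} (hr : ∀ i j, r i j = r j i)
    (hc : EdgesConnected r) :
    ∃! R, HasRootForm r R ∧ ∀ R', HasRootForm r R' → R.entries ≤ R'.entries := by
  obtain ⟨R₀, hR₀⟩ := exists_hasRootForm hr hc
  obtain ⟨L, ⟨R, hR, rfl⟩, hmin⟩ := Set.exists_min_image _ id (finite_entries r)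
    ⟨_, R₀, hR₀, rfl⟩
  refine ⟨R, ⟨hR, fun R' hR' => hmin _ ⟨R', hR', rfl⟩⟩, ?_⟩
  rintro R' ⟨hR', hmin'⟩
  exact hR'.ext hr hR (le_antisymm (hmin' R hR) (hmin _ ⟨R', hR', rfl⟩))

end RootForms

/-! ### Well-definedness of the root invariant of a superbase. -/

section RootInvariant

variable (B : ObtuseSuperbase)

theorem ObtuseSuperbase.sum_v_ne_zero {S : Finset (Fin 4)} (hS : S.Nonempty)
    (hS' : Sᶜ.Nonempty) : ∑ i ∈ S, B.v i ≠ 0 := by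
  intro h
  set c : Fin 4 → ℝ := fun i => if i ∈ S then 1 else 0 with hc
  have h0 : ∑ i, c i • B.v i = 0 := by
    rw [← h]; simp [hc, ite_smul, Finset.sum_ite_mem]
  have hv := B.v_zero
  have h1 : ∑ i, (fun i : Fin 3 => c i.succ - c 0) i • ![B.v 1, B.v 2, B.v 3] i = 0 := by
    rw [← h0, Fin.sum_univ_four, Fin.sum_univ_three, hv]
    simp only [Matrix.cons_val, sub_smul, smul_sub, smul_neg]
    change (c 1 • _ - _) + (c 2 • _ - _) + (c 3 • _ - _) = _
    abel
  have h2 := Fintype.linearIndependent_iff.1 B.linearIndependent _ h1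
  have h3 : ∀ i, c i = c 0 := Fin.cases rfl fun i => sub_eq_zero.1 (h2 i)
  obtain ⟨i, hi⟩ := hS
  obtain ⟨j, hj⟩ := hS'
  have h4 := (h3 i).trans (h3 j).symm
  simp [hc, hi, Finset.mem_compl.1 hj] at h4

/-- A cut without non-zero edges has weight zero, which is the squared length of a proper partial
sum. -/
theorem ObtuseSuperbase.edgesConnected : EdgesConnected B.rootProduct := by
  intro S hS hS'
  by_contra! hcon
  refine B.sum_v_ne_zero hS hS' (inner_self_eq_zero (𝕜 := ℝ).1 ?_)
  rw [inner_sum_self_eq_cutWeight B.sum_v]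
  refine Finset.sum_eq_zero fun i hi => Finset.sum_eq_zero fun j hj => ?_
  exact (B.rootProduct_eq_zero_iff fun h => by
    subst h; exact (Finset.mem_compl.1 hj) hi).1 (hcon i hi j hj)

theorem isRootArrangement_iff_hasRootForm {R : RootInvariant} :
    IsRootArrangement B R ↔ HasRootForm B.rootProduct R := isRootArrangement_iff

theorem existsUnique_isRootInvariant : ∃! R, IsRootInvariant B R := by
  simp only [IsRootInvariant, isRootArrangement_iff_hasRootForm]
  exact existsUnique_minimal_rootForm B.rootProduct_comm B.edgesConnected

end RootInvariant

/-! ### Automorphisms of the conorm space and index-permutations. -/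

section ConormSpace

/-- The space of even subsets of `{0, 1, 2, 3}`, which carries the conorms. -/
abbrev ConormSpace : Type := Fin 3 → ZMod 2

/-- The even subset `{0, i}`. -/
def conormPoint : Fin 4 → ConormSpace := ![![0, 0, 0], ![1, 0, 0], ![0, 1, 0], ![0, 0, 1]]

/-- The even subset `{i, j}`. -/
def conormEdge (i j : Fin 4) : ConormSpace := conormPoint i + conormPoint j

/-- The even subset `{0, 1, 2, 3}`. -/
def conormFull : ConormSpace := ![1, 1, 1]

/-- The linear map of the space of even subsets with the given values on a basis. -/
def conormMap (α β γ : ConormSpace) (w : ConormSpace) : ConormSpace :=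
  fun k => w 0 * α k + w 1 * β k + w 2 * γ k

theorem conormMap_add (α β γ w w' : ConormSpace) :
    conormMap α β γ (w + w') = conormMap α β γ w + conormMap α β γ w' := by
  funext k
  simp only [conormMap, Pi.add_apply]
  ring

theorem conormMap_conormPoint (α β γ : ConormSpace) (i : Fin 4) :
    conormMap α β γ (conormPoint i) = ![0, α, β, γ] i := by
  fin_cases i <;> funext k <;> simp [conormMap, conormPoint]

theorem ConormSpace.add_self (w : ConormSpace) : w + w = 0 :=
  funext fun _ => CharTwo.add_self_eq_zero _

theorem ConormSpace.eq_of_ne_zero : ∀ z : ConormSpace, z ≠ 0 → z = conormFull ∨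
    z = conormEdge 0 1 ∨ z = conormEdge 0 2 ∨ z = conormEdge 0 3 ∨ z = conormEdge 1 2 ∨
    z = conormEdge 1 3 ∨ z = conormEdge 2 3 := by
  decide +kernel

theorem conormEdge_ne_zero : ∀ i j : Fin 4, i ≠ j → conormEdge i j ≠ 0 := by
  decide +kernel

theorem conormFull_eq_sum : conormFull = ∑ i, conormPoint i := by
  decide +kernel

-- None of the three is the full set, or the other two would coincide. So they are distinct edges
-- with odd degree at all four vertices; the degrees sum to six, hence are 3, 1, 1, 1, a star.
set_option synthInstance.maxSize 2000 in
set_option synthInstance.maxHeartbeats 400000 in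
theorem exists_conormEdge_of_add_eq_conormFull : ∀ α β γ : ConormSpace, α + β + γ = conormFull →
    α ≠ 0 → β ≠ 0 → γ ≠ 0 → α ≠ β → α ≠ γ → β ≠ γ →
    ∃ w x y z : Fin 4, (w ≠ x ∧ w ≠ y ∧ w ≠ z ∧ x ≠ y ∧ x ≠ z ∧ y ≠ z) ∧
      α = conormEdge w x ∧ β = conormEdge w y ∧ γ = conormEdge w z := by
  decide +kernel

/-- A linear automorphism of the conorm space that fixes the full set is an index-permutation. -/
theorem exists_perm_of_map_conormFull {g : ConormSpace → ConormSpace}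
    (hadd : ∀ a b, g (a + b) = g a + g b) (hinj : Function.Injective g)
    (hfull : g conormFull = conormFull) :
    ∃ σ : Equiv.Perm (Fin 4), ∀ i j, g (conormEdge i j) = conormEdge (σ i) (σ j) := by
  have h0 : g 0 = 0 := by simpa using hadd 0 0
  have hne : ∀ {a b}, a ≠ b → g a ≠ g b := fun h => hinj.ne h
  have hne0 : ∀ {a}, a ≠ 0 → g a ≠ 0 := fun h => h0 ▸ hinj.ne h
  obtain ⟨w, x, y, z, ⟨h1, h2, h3, h4, h5, h6⟩, hα, hβ, hγ⟩ :=
    exists_conormEdge_of_add_eq_conormFull (g (conormPoint 1)) (g (conormPoint 2))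
    (g (conormPoint 3)) (by rw [← hadd, ← hadd, ← hfull]; congr 1; decide +kernel)
    (hne0 (by decide +kernel)) (hne0 (by decide +kernel)) (hne0 (by decide +kernel))
    (hne (by decide +kernel)) (hne (by decide +kernel)) (hne (by decide +kernel))
  refine ⟨Equiv.ofBijective _ (Finite.injective_iff_bijective.1
    (vec_injective h1 h2 h3 h4 h5 h6)), fun i j => ?_⟩
  have hp : ∀ i, g (conormPoint i) = conormEdge w (![w, x, y, z] i) := by
    intro i
    fin_cases i
    · change g (conormPoint 0) = conormEdge w w
      rw [conormEdge, ConormSpace.add_self, ← h0]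
      congr 1
      decide +kernel
    · exact hα
    · exact hβ
    · exact hγ
  rw [conormEdge, hadd, hp, hp]
  simp only [conormEdge, Equiv.ofBijective_apply]
  rw [add_add_add_comm, ConormSpace.add_self, zero_add]

/-- Index-permutations are linear automorphisms of the conorm space. -/
theorem exists_map_of_perm (σ : Equiv.Perm (Fin 4)) : ∃ g : ConormSpace → ConormSpace,
    (∀ a b, g (a + b) = g a + g b) ∧ Function.Injective g ∧ g conormFull = conormFull ∧
    ∀ i j, g (conormEdge i j) = conormEdge (σ i) (σ j) := by
  set g := conormMap (conormEdge (σ 0) (σ 1)) (conormEdge (σ 0) (σ 2)) (conormEdge (σ 0) (σ 3))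
    with hg
  have hadd : ∀ a b, g (a + b) = g a + g b := conormMap_add _ _ _
  have hp : ∀ i, g (conormPoint i) = conormEdge (σ 0) (σ i) := by
    intro i
    rw [hg, conormMap_conormPoint]
    fin_cases i
    · exact (ConormSpace.add_self _).symm
    all_goals rfl
  have he : ∀ i j, g (conormEdge i j) = conormEdge (σ i) (σ j) := by
    intro i j
    rw [conormEdge, hadd, hp, hp]
    simp only [conormEdge]
    rw [add_add_add_comm, ConormSpace.add_self, zero_add]
  have hfull : g conormFull = conormFull := by
    have h : conormFull = conormEdge 0 1 + conormEdge 2 3 := by decide +kernel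
    have h' : conormFull = ∑ i, conormPoint (σ i) := by
      rw [conormFull_eq_sum, Equiv.sum_comp σ]
    rw [h, hadd, he, he, ← h, h', Fin.sum_univ_four]
    simp only [conormEdge]
    abel
  refine ⟨g, hadd, ?_, hfull, he⟩
  have h0 : ∀ a, g a = 0 → a = 0 := by
    intro a ha
    by_contra hne
    rcases ConormSpace.eq_of_ne_zero a hne with h | h | h | h | h | h | h <;> rw [h] at ha
    · rw [hfull] at ha
      exact absurd ha (by decide +kernel)
    all_goals
      rw [he] at ha
      exact conormEdge_ne_zero _ _ (σ.injective.ne (by decide)) ha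
  intro a b hab
  have : a + b = 0 := h0 _ (by rw [hadd, hab, ConormSpace.add_self])
  rw [← add_right_cancel_iff (a := b), this, ConormSpace.add_self]

theorem OrderedRootForm.congr {r r' : Fin 4 → Fin 4 → ℝ} {L : List ℝ} {T : VoronoiType}
    (h : OrderedRootForm r L T) (h01 : r' 0 1 = r 0 1) (h02 : r' 0 2 = r 0 2)
    (h03 : r' 0 3 = r 0 3) (h12 : r' 1 2 = r 1 2) (h13 : r' 1 3 = r 1 3)
    (h23 : r' 2 3 = r 2 3) : OrderedRootForm r' L T := by
  cases T <;> simpa only [OrderedRootForm, h01, h02, h03, h12, h13, h23] using h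

theorem IsIncreasingOrderOf.of_perm {L L₁ L₂ : List ℝ} (h : IsIncreasingOrderOf L L₁)
    (hp : L₁.Perm L₂) : IsIncreasingOrderOf L L₂ := ⟨h.1.trans hp, h.2⟩

/-- If the conorms vanish at a point `z` besides the full set, then the conorm space has an
automorphism taking the full set to `z` and preserving the ordered root form. -/
theorem exists_conormMap_of_apply_eq_zero {q : ConormSpace → ℝ} (hq : q conormFull = 0)
    {L : List ℝ} {T : VoronoiType} (h : OrderedRootForm (fun i j => q (conormEdge i j)) L T)
    {z : ConormSpace} (hz0 : z ≠ 0) (hz : q z = 0) :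
    ∃ α β γ : ConormSpace, Function.Injective (conormMap α β γ) ∧
      conormMap α β γ conormFull = z ∧
      OrderedRootForm (fun i j => q (conormMap α β γ (conormEdge i j))) L T := by
  -- Each case below names the images of the six edges: the facts on `𝔽₂³` are decidable, and the
  -- form remains to be checked on the relocated values.
  have mk : ∀ (α β γ e01 e02 e03 e12 e13 e23 : ConormSpace),
      (Function.Injective (conormMap α β γ) ∧ conormMap α β γ conormFull = z ∧
        conormMap α β γ (conormEdge 0 1) = e01 ∧ conormMap α β γ (conormEdge 0 2) = e02 ∧
        conormMap α β γ (conormEdge 0 3) = e03 ∧ conormMap α β γ (conormEdge 1 2) = e12 ∧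
        conormMap α β γ (conormEdge 1 3) = e13 ∧ conormMap α β γ (conormEdge 2 3) = e23) →
      OrderedRootForm (edgeWeights (q e01) (q e02) (q e03) (q e12) (q e13) (q e23)) L T →
      ∃ α β γ : ConormSpace, Function.Injective (conormMap α β γ) ∧
        conormMap α β γ conormFull = z ∧
        OrderedRootForm (fun i j => q (conormMap α β γ (conormEdge i j))) L T := by
    rintro α β γ _ _ _ _ _ _ ⟨hi, hf, rfl, rfl, rfl, rfl, rfl, rfl⟩ h
    exact ⟨α, β, γ, hi, hf, h.congr rfl rfl rfl rfl rfl rfl⟩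
  rcases ConormSpace.eq_of_ne_zero z hz0 with rfl | hz'
  · refine mk ![1, 0, 0] ![0, 1, 0] ![0, 0, 1]
        (conormEdge 0 1) (conormEdge 0 2) (conormEdge 0 3)
        (conormEdge 1 2) (conormEdge 1 3) (conormEdge 2 3) (by decide +kernel)
        (h.congr rfl rfl rfl rfl rfl rfl)
  cases T with
  | V1 =>
    obtain ⟨⟨h23, h13, h12, h01, h02, h03⟩, -⟩ := h
    rcases hz' with rfl | rfl | rfl | rfl | rfl | rfl
    · exact absurd hz h01
    · exact absurd hz h02
    · exact absurd hz h03
    · exact absurd hz h12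
    · exact absurd hz h13
    · exact absurd hz h23
  | V2 =>
    obtain ⟨⟨h23, h13, h12, h01, h02, h03⟩, A, hA, h1, h2, h3, h4, rfl⟩ := h
    rcases hz' with rfl | rfl | rfl | rfl | rfl | rfl
    · exact absurd hz h01
    · exact absurd hz h02
    · exact absurd hz h03
    · exact absurd hz h12
    · exact absurd hz h13
    -- This exchanges `r₁₃` with `r₀₃`, a diagonal reflection of the square. Index-permutations that
    -- keep the zero in place give only row and column swaps, so the full `D₄` is needed in the `V2`
    -- rule.
    · refine mk ![1, 0, 0] ![0, 1, 0] ![1, 0, 1]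
          (conormEdge 0 1) (conormEdge 0 2) (conormEdge 1 3)
          (conormEdge 1 2) (conormEdge 0 3) conormFull (by decide +kernel)
          ⟨⟨hq, h03, h12, h01, h02, h13⟩, A, .trans ⟨.swap 0 1, .swap 0 1, Or.inr <| by
            ext i j; fin_cases i <;> fin_cases j <;> rfl⟩ hA, h1, h2, h3, h4, rfl⟩
  | V3 =>
    obtain ⟨⟨h23, h01, h13, h12, h02, h03⟩, h⟩ := h
    rcases hz' with rfl | rfl | rfl | rfl | rfl | rfl
    · refine mk ![1, 1, 1] ![0, 1, 0] ![0, 0, 1]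
          conormFull (conormEdge 0 2) (conormEdge 0 3)
          (conormEdge 1 3) (conormEdge 1 2) (conormEdge 2 3) (by decide +kernel)
          (⟨⟨h23, hq, h12, h13, h02, h03⟩,
            h.of_perm (by simp only [edgeWeights, Matrix.cons_val]; grind)⟩)
    · exact absurd hz h02
    · exact absurd hz h03
    · exact absurd hz h12
    · exact absurd hz h13
    · refine mk ![1, 0, 0] ![0, 1, 0] ![1, 0, 1]
          (conormEdge 0 1) (conormEdge 0 2) (conormEdge 1 3)
          (conormEdge 1 2) (conormEdge 0 3) conormFull (by decide +kernel)
          (⟨⟨hq, h01, h03, h12, h02, h13⟩,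
            h.of_perm (by simp only [edgeWeights, Matrix.cons_val]; grind)⟩)
  | V4 =>
    obtain ⟨⟨h23, h13, h12, h01, h02, h03⟩, L₃, h, rfl⟩ := h
    rcases hz' with rfl | rfl | rfl | rfl | rfl | rfl
    · exact absurd hz h01
    · exact absurd hz h02
    · exact absurd hz h03
    · exact absurd hz h12
    · refine mk ![1, 1, 0] ![0, 1, 0] ![0, 0, 1]
          (conormEdge 1 2) (conormEdge 0 2) (conormEdge 0 3)
          (conormEdge 0 1) conormFull (conormEdge 2 3) (by decide +kernel)
          (⟨⟨h23, hq, h01, h12, h02, h03⟩, L₃,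
            h.of_perm (by simp only [edgeWeights, Matrix.cons_val]; grind), rfl⟩)
    · refine mk ![1, 0, 0] ![1, 1, 0] ![0, 0, 1]
          (conormEdge 0 1) (conormEdge 1 2) (conormEdge 0 3)
          (conormEdge 0 2) (conormEdge 1 3) conormFull (by decide +kernel)
          (⟨⟨hq, h13, h02, h01, h12, h03⟩, L₃,
            h.of_perm (by simp only [edgeWeights, Matrix.cons_val]; grind), rfl⟩)
  | V5 =>
    rcases h with ⟨⟨h23, h13, h12, h01, h02, h03⟩, h⟩ | ⟨⟨h23, h13, h01, h12, h02, h03⟩, h⟩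
    · rcases hz' with rfl | rfl | rfl | rfl | rfl | rfl
      · exact absurd hz h01
      · exact absurd hz h02
      · exact absurd hz h03
      -- Moving the full set to any zero edge turns the star into a path, so a `V5` lattice needs
      -- both alternatives.
      · refine mk ![1, 0, 1] ![0, 0, 1] ![0, 1, 0]
            (conormEdge 1 3) (conormEdge 0 3) (conormEdge 0 2)
            (conormEdge 0 1) conormFull (conormEdge 2 3) (by decide +kernel)
            (Or.inr ⟨⟨h23, hq, h13, h01, h03, h02⟩,
              h.of_perm (by simp only [edgeWeights, Matrix.cons_val]; grind)⟩)
      · refine mk ![1, 1, 0] ![0, 1, 0] ![0, 0, 1]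
            (conormEdge 1 2) (conormEdge 0 2) (conormEdge 0 3)
            (conormEdge 0 1) conormFull (conormEdge 2 3) (by decide +kernel)
            (Or.inr ⟨⟨h23, hq, h12, h01, h02, h03⟩,
              h.of_perm (by simp only [edgeWeights, Matrix.cons_val]; grind)⟩)
      · refine mk ![1, 1, 0] ![1, 0, 0] ![0, 0, 1]
            (conormEdge 1 2) (conormEdge 0 1) (conormEdge 0 3)
            (conormEdge 0 2) conormFull (conormEdge 1 3) (by decide +kernel)
            (Or.inr ⟨⟨h13, hq, h12, h02, h01, h03⟩,
              h.of_perm (by simp only [edgeWeights, Matrix.cons_val]; grind)⟩)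
    · rcases hz' with rfl | rfl | rfl | rfl | rfl | rfl
      · refine mk ![1, 1, 1] ![0, 0, 1] ![0, 1, 0]
            conormFull (conormEdge 0 3) (conormEdge 0 2)
            (conormEdge 1 2) (conormEdge 1 3) (conormEdge 2 3) (by decide +kernel)
            (Or.inr ⟨⟨h23, h13, hq, h12, h03, h02⟩,
              h.of_perm (by simp only [edgeWeights, Matrix.cons_val]; grind)⟩)
      · exact absurd hz h02
      · exact absurd hz h03
      · exact absurd hz h12
      -- The middle zero `{1,3}` is the only one that turns the path into a star.
      · refine mk ![0, 0, 1] ![0, 1, 0] ![1, 1, 0]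
            (conormEdge 0 3) (conormEdge 0 2) (conormEdge 1 2)
            (conormEdge 2 3) conormFull (conormEdge 0 1) (by decide +kernel)
            (Or.inl ⟨⟨h01, hq, h23, h03, h02, h12⟩,
              h.of_perm (by simp only [edgeWeights, Matrix.cons_val]; grind)⟩)
      · refine mk ![1, 0, 0] ![1, 1, 0] ![0, 0, 1]
            (conormEdge 0 1) (conormEdge 1 2) (conormEdge 0 3)
            (conormEdge 0 2) (conormEdge 1 3) conormFull (by decide +kernel)
            (Or.inr ⟨⟨hq, h13, h01, h02, h12, h03⟩,
              h.of_perm (by simp only [edgeWeights, Matrix.cons_val]; grind)⟩)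

/-- Conorm functions that differ by a linear automorphism have the same ordered root forms. -/
theorem HasRootForm.of_conorm_automorphism {q q' : ConormSpace → ℝ} {g : ConormSpace → ConormSpace}
    (hadd : ∀ a b, g (a + b) = g a + g b) (hinj : Function.Injective g)
    (hg : ∀ u, q' u = q (g u)) (hq : q conormFull = 0) (hq' : q' conormFull = 0)
    {R : RootInvariant} (h : HasRootForm (fun i j => q' (conormEdge i j)) R) :
    HasRootForm (fun i j => q (conormEdge i j)) R := by
  obtain ⟨σ, h⟩ := h
  obtain ⟨s, hsadd, hsinj, hsfull, hs⟩ := exists_map_of_perm σ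
  simp only [← hs] at h
  -- Here `z` is the point that `g ∘ s` sends to the full set, so `q' ∘ s` vanishes at `z`.
  -- Precomposing with an automorphism that takes the full set to `z` gives a map fixing the full
  -- set, that is, an index-permutation.
  obtain ⟨z, hz⟩ := Finite.injective_iff_surjective.1 (hinj.comp hsinj) conormFull
  have hs0 : s 0 = 0 := by simpa using hsadd 0 0
  have hg0 : g 0 = 0 := by simpa using hadd 0 0
  have hz0 : z ≠ 0 := by
    rintro rfl
    rw [Function.comp_apply, hs0, hg0] at hz
    exact absurd hz (by decide +kernel)
  obtain ⟨α, β, γ, htinj, htfull, ht⟩ := exists_conormMap_of_apply_eq_zero (q := q' ∘ s)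
    (by rw [Function.comp_apply, hsfull, hq']) h hz0 (by
      rw [Function.comp_apply, hg]
      exact (congrArg q hz).trans hq)
  obtain ⟨τ, hτ⟩ := exists_perm_of_map_conormFull (g := (g ∘ s) ∘ conormMap α β γ)
    (fun a b => by simp only [Function.comp_apply, conormMap_add, hsadd, hadd])
    ((hinj.comp hsinj).comp htinj) (by rw [Function.comp_apply, htfull, hz])
  refine ⟨τ, ?_⟩
  simp only [← hτ]
  simpa only [Function.comp_apply, hg] using ht

end ConormSpace

/-! ### Vonorms, their Fourier transform, and change of superbase. -/

section Vonorm

open scoped Matrix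

/-- The minimal squared length of the vectors of a class of a lattice modulo its double. -/
noncomputable def vonorm (p : Fin 4 → Fin 4 → ℝ) (w : ConormSpace) : ℝ :=
  (∑ i, ∑ j, if (Fin.cons 0 w : Fin 4 → ZMod 2) i ≠ (Fin.cons 0 w : Fin 4 → ZMod 2) j
    then p i j else 0) / 2

/-- The character of the even subset `u`, as a sign. -/
def conormSign (u w : ConormSpace) : ℤ := if u ⬝ᵥ w = 0 then 1 else -1

/-- The conorm function, a Fourier transform of the vonorms. -/
noncomputable def conormFunction (p : Fin 4 → Fin 4 → ℝ) (u : ConormSpace) : ℝ :=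
  -(∑ w, (conormSign u w : ℝ) * vonorm p w) / 4

/-- The Fourier coefficients of the cut of an edge. -/
def cutCoefficient (u : ConormSpace) (i j : Fin 4) : ℤ :=
  ∑ w, conormSign u w *
    if (Fin.cons 0 w : Fin 4 → ZMod 2) i ≠ (Fin.cons 0 w : Fin 4 → ZMod 2) j then 1 else 0

/-- For `i ≠ j`, the indicator that `w` separates `i` from `j` is `(1 - χ) / 2` with `χ` the
character of `{i,j}`. By orthogonality only the coefficients at `0` and at `{i,j}` survive. -/
theorem cutCoefficient_conormFull : ∀ i j, cutCoefficient conormFull i j = 0 := by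
  decide +kernel

theorem cutCoefficient_conormEdge : ∀ k l, k ≠ l → ∀ i j,
    cutCoefficient (conormEdge k l) i j =
      if i = k ∧ j = l ∨ i = l ∧ j = k then -4 else 0 := by
  decide +kernel

theorem conormFunction_eq (p : Fin 4 → Fin 4 → ℝ) (u : ConormSpace) :
    conormFunction p u = -(∑ i, ∑ j, p i j * cutCoefficient u i j) / 8 := by
  have h : ∑ i, ∑ j, p i j * (cutCoefficient u i j : ℝ) =
      ∑ w, (conormSign u w : ℝ) * (2 * vonorm p w) := by
    simp only [cutCoefficient, vonorm, Int.cast_sum, Int.cast_mul, Finset.mul_sum]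
    rw [Finset.sum_congr rfl fun i _ => Finset.sum_comm, Finset.sum_comm]
    refine Finset.sum_congr rfl fun w _ => ?_
    rw [mul_div_cancel₀ _ two_ne_zero, Finset.mul_sum]
    refine Finset.sum_congr rfl fun i _ => ?_
    rw [Finset.mul_sum]
    refine Finset.sum_congr rfl fun j _ => ?_
    split_ifs <;> simp [mul_comm]
  rw [h, conormFunction]
  simp only [mul_left_comm _ (2 : ℝ), ← Finset.mul_sum]
  ring

theorem conormFunction_conormFull (p : Fin 4 → Fin 4 → ℝ) : conormFunction p conormFull = 0 := by
  simp [conormFunction_eq, cutCoefficient_conormFull]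

/-- The ordered pairs `(k, l)` and `(l, k)` contribute `-4 * p k l` each, against the factor `-1 /
8`. -/
theorem conormFunction_conormEdge {p : Fin 4 → Fin 4 → ℝ} (hp : ∀ i j, p i j = p j i)
    {k l : Fin 4} (hkl : k ≠ l) : conormFunction p (conormEdge k l) = p k l := by
  have h : ∀ i j, p i j * (cutCoefficient (conormEdge k l) i j : ℝ) =
      (if i = k then if j = l then p k l * (-4) else 0 else 0) +
      (if i = l then if j = k then p k l * (-4) else 0 else 0) := by
    intro i j
    rw [cutCoefficient_conormEdge k l hkl]
    by_cases h1 : i = k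
    · subst h1
      by_cases h2 : j = l
      · subst h2; simp [hkl]
      · simp [h2, hkl]
    · by_cases h2 : i = l
      · subst h2
        by_cases h3 : j = k
        · subst h3; simp [h1, hp i j]
        · simp [h1, h3]
      · simp [h1, h2]
  simp only [conormFunction_eq, h, Finset.sum_add_distrib, Finset.sum_ite_irrel,
    Finset.sum_const_zero, Finset.sum_ite_eq', Finset.mem_univ, if_true]
  ring

namespace ObtuseSuperbase

variable (B : ObtuseSuperbase)

theorem inner_sum_smul_succ (n : Fin 3 → ℤ) :
    ⟪∑ i, (n i : ℝ) • B.v i.succ, ∑ i, (n i : ℝ) • B.v i.succ⟫ =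
      (∑ i, ∑ j, B.conorm i j * (((Fin.cons 0 n : Fin 4 → ℤ) i : ℝ) -
        (Fin.cons 0 n : Fin 4 → ℤ) j) ^ 2) / 2 := by
  have := inner_sum_smul_self B.sum_v fun i => ((Fin.cons 0 n : Fin 4 → ℤ) i : ℝ)
  rw [Fin.sum_univ_succ (n := 3)] at this
  simpa only [conorm, Fin.cons_zero, Fin.cons_succ, Int.cast_zero, zero_smul, zero_add] using this

theorem cast_cons (n : Fin 3 → ℤ) (i : Fin 4) :
    (Fin.cons 0 (fun k => (n k : ZMod 2)) : Fin 4 → ZMod 2) i =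
      ((Fin.cons 0 n : Fin 4 → ℤ) i : ZMod 2) := by
  cases i using Fin.cases <;> simp

/-- In Selling's formula, coordinates of different parity have squared difference at least 1. With
`exists_inner_eq_vonorm`, where coordinates 0 and 1 give equality, this makes the vonorm the minimum
over a class modulo `2Λ`. -/
theorem vonorm_le (n : Fin 3 → ℤ) : vonorm B.conorm (fun i => (n i : ZMod 2)) ≤
    ⟪∑ i, (n i : ℝ) • B.v i.succ, ∑ i, (n i : ℝ) • B.v i.succ⟫ := by
  rw [inner_sum_smul_succ, vonorm]
  gcongr with i _ j _
  rw [cast_cons, cast_cons]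
  set m := (Fin.cons 0 n : Fin 4 → ℤ)
  split_ifs with h
  · have hm : m i ≠ m j := fun e => h (by rw [e])
    have hij : i ≠ j := fun e => h (by rw [e])
    have h1 : (1 : ℤ) ≤ (m i - m j) ^ 2 := by
      have := sq_pos_of_ne_zero (sub_ne_zero.2 hm)
      omega
    have h2 : (1 : ℝ) ≤ ((m i : ℝ) - m j) ^ 2 := by exact_mod_cast h1
    nlinarith [B.conorm_nonneg hij]
  · rcases eq_or_ne i j with rfl | hij
    · simp
    · exact mul_nonneg (B.conorm_nonneg hij) (sq_nonneg _)

theorem exists_inner_eq_vonorm (w : ConormSpace) : ∃ n : Fin 3 → ℤ,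
    (fun i => (n i : ZMod 2)) = w ∧
    ⟪∑ i, (n i : ℝ) • B.v i.succ, ∑ i, (n i : ℝ) • B.v i.succ⟫ = vonorm B.conorm w := by
  have hw : (fun i => (((w i).val : ℤ) : ZMod 2)) = w := by
    funext i; simp
  refine ⟨fun i => ((w i).val : ℤ), hw, ?_⟩
  conv_rhs => rw [← hw]
  rw [inner_sum_smul_succ, vonorm]
  congr 1
  refine Finset.sum_congr rfl fun i _ => Finset.sum_congr rfl fun j _ => ?_
  rw [cast_cons, cast_cons]
  have h01 : ∀ i, (Fin.cons 0 (fun i => ((w i).val : ℤ)) : Fin 4 → ℤ) i = 0 ∨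
      (Fin.cons 0 (fun i => ((w i).val : ℤ)) : Fin 4 → ℤ) i = 1 := by
    intro i
    cases i using Fin.cases with
    | zero => exact Or.inl rfl
    | succ i =>
      have := ZMod.val_lt (w i)
      rw [Fin.cons_succ]
      omega
  rcases h01 i with hi | hi <;> rcases h01 j with hj | hj <;> rw [hi, hj] <;> simp

theorem exists_intMatrix {B B' : ObtuseSuperbase} (h : B.lattice = B'.lattice) :
    ∃ M : Matrix (Fin 3) (Fin 3) ℤ,
      ∀ i : Fin 3, B'.v i.succ = ∑ k : Fin 3, (M i k : ℝ) • B.v k.succ := by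
  have : ∀ i : Fin 3, ∃ n : Fin 3 → ℤ, B'.v i.succ = ∑ k : Fin 3, (n k : ℝ) • B.v k.succ := by
    intro i
    rw [← B.mem_lattice_iff, h, B'.mem_lattice_iff]
    exact ⟨Pi.single i 1, by simp [Pi.single_apply, ite_smul]⟩
  choose M hM using this
  exact ⟨M, hM⟩

theorem sum_vecMul {B B' : ObtuseSuperbase} {M : Matrix (Fin 3) (Fin 3) ℤ}
    (hM : ∀ i : Fin 3, B'.v i.succ = ∑ k : Fin 3, (M i k : ℝ) • B.v k.succ) (n : Fin 3 → ℤ) :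
    ∑ i : Fin 3, (n i : ℝ) • B'.v i.succ = ∑ k : Fin 3, ((n ᵥ* M) k : ℝ) • B.v k.succ := by
  simp only [hM, Finset.smul_sum, Matrix.vecMul, dotProduct, Int.cast_sum, Int.cast_mul,
    Finset.sum_smul, smul_smul]
  exact Finset.sum_comm

theorem linearIndependent_succ : LinearIndependent ℝ fun i : Fin 3 => B.v i.succ := by
  convert B.linearIndependent using 1
  funext i
  fin_cases i <;> rfl

theorem intMatrix_mul_eq_one {B B' : ObtuseSuperbase} {M M' : Matrix (Fin 3) (Fin 3) ℤ}
    (hM : ∀ i : Fin 3, B'.v i.succ = ∑ k : Fin 3, (M i k : ℝ) • B.v k.succ)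
    (hM' : ∀ i : Fin 3, B.v i.succ = ∑ k : Fin 3, (M' i k : ℝ) • B'.v k.succ) :
    M * M' = 1 := by
  ext i k
  have h1 : ∑ k : Fin 3, ((M * M') i k : ℝ) • B'.v k.succ =
      ∑ k : Fin 3, (((1 : Matrix (Fin 3) (Fin 3) ℤ) i k : ℤ) : ℝ) • B'.v k.succ := by
    have h2 := sum_vecMul hM' (M i)
    rw [← hM i] at h2
    have h3 : M i ᵥ* M' = (M * M') i := by
      funext k; simp [Matrix.vecMul, Matrix.mul_apply, dotProduct]
    rw [h3] at h2
    rw [← h2]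
    simp [Matrix.one_apply, ite_smul]
  have h4 := Fintype.linearIndependent_iff.1 B'.linearIndependent_succ
    (fun k => ((M * M') i k : ℝ) - (((1 : Matrix (Fin 3) (Fin 3) ℤ) i k : ℤ) : ℝ))
    (by simp only [sub_smul, Finset.sum_sub_distrib, h1, sub_self]) k
  exact_mod_cast sub_eq_zero.1 h4

/-- A shortest vector of a class, rewritten in the other superbase, lies in the transformed class.
Both directions together give equality. -/
theorem vonorm_vecMul_le {B B' : ObtuseSuperbase} {M : Matrix (Fin 3) (Fin 3) ℤ}
    (hM : ∀ i : Fin 3, B'.v i.succ = ∑ k : Fin 3, (M i k : ℝ) • B.v k.succ) (w : ConormSpace) :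
    vonorm B.conorm (w ᵥ* M.map (Int.cast : ℤ → ZMod 2)) ≤ vonorm B'.conorm w := by
  obtain ⟨n, rfl, hn⟩ := B'.exists_inner_eq_vonorm w
  rw [← hn, sum_vecMul hM]
  refine le_of_eq_of_le ?_ (B.vonorm_le _)
  congr 1
  funext k
  simp [Matrix.vecMul, dotProduct]

/-- The conorm functions of two obtuse superbases of a lattice differ by a linear automorphism. -/
theorem exists_conormFunction_automorphism {B B' : ObtuseSuperbase} (h : B.lattice = B'.lattice) :
    ∃ g : ConormSpace → ConormSpace, (∀ a b, g (a + b) = g a + g b) ∧ Function.Injective g ∧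
      ∀ u, conormFunction B'.conorm u = conormFunction B.conorm (g u) := by
  obtain ⟨M, hM⟩ := exists_intMatrix h
  obtain ⟨M', hM'⟩ := exists_intMatrix h.symm
  set A := M.map (Int.cast : ℤ → ZMod 2) with hA
  set A' := M'.map (Int.cast : ℤ → ZMod 2) with hA'
  have hmul : ∀ X Y : Matrix (Fin 3) (Fin 3) ℤ, X * Y = 1 →
      X.map (Int.cast : ℤ → ZMod 2) * Y.map (Int.cast : ℤ → ZMod 2) = 1 := by
    intro X Y hXY
    have := Matrix.map_mul (L := X) (M := Y) (f := Int.castRingHom (ZMod 2))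
    rw [hXY] at this
    simpa using this.symm
  have hAA' : A * A' = 1 := hmul _ _ (intMatrix_mul_eq_one hM hM')
  have hA'A : A' * A = 1 := hmul _ _ (intMatrix_mul_eq_one hM' hM)
  have hvon : ∀ w, vonorm B'.conorm w = vonorm B.conorm (w ᵥ* A) := by
    intro w
    refine le_antisymm ?_ (vonorm_vecMul_le hM w)
    have := vonorm_vecMul_le hM' (w ᵥ* A)
    rwa [← hA', Matrix.vecMul_vecMul, hAA', Matrix.vecMul_one] at this
  let e : ConormSpace ≃ ConormSpace :=
    { toFun := fun w => w ᵥ* A'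
      invFun := fun w => w ᵥ* A
      left_inv := fun w => by beta_reduce; rw [Matrix.vecMul_vecMul, hA'A, Matrix.vecMul_one]
      right_inv := fun w => by beta_reduce; rw [Matrix.vecMul_vecMul, hAA', Matrix.vecMul_one] }
  -- Vonorms transform by `w ↦ w ᵥ* A`; reindexing the Fourier sum by the inverse `A'` and moving it
  -- across the pairing gives the dual action on `u`.
  refine ⟨fun u => A' *ᵥ u, Matrix.mulVec_add A', fun a b hab => ?_, fun u => ?_⟩
  · have : A *ᵥ (A' *ᵥ a) = A *ᵥ (A' *ᵥ b) := congrArg _ hab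
    simpa only [Matrix.mulVec_mulVec, hAA', Matrix.one_mulVec] using this
  · have hsign : ∀ w, conormSign u (e w) = conormSign (A' *ᵥ u) w := by
      intro w
      rw [conormSign, conormSign, dotProduct_comm, dotProduct_comm (A' *ᵥ u),
        Matrix.dotProduct_mulVec]
      rfl
    have hinv : ∀ w, e w ᵥ* A = w := e.left_inv
    simp only [conormFunction]
    rw [← e.sum_comp]
    simp only [hvon, hinv, hsign]

/-- Root forms read off-diagonal entries only, and there the root product is the square root of the
conorm function. -/
theorem hasRootForm_of_lattice_eq {B B' : ObtuseSuperbase} (h : B.lattice = B'.lattice)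
    {R : RootInvariant} (hR : HasRootForm B'.rootProduct R) : HasRootForm B.rootProduct R := by
  obtain ⟨g, hadd, hinj, hg⟩ := exists_conormFunction_automorphism h
  have hedge : ∀ (B : ObtuseSuperbase) (i j), i ≠ j →
      √(conormFunction B.conorm (conormEdge i j)) = B.rootProduct i j := fun B i j hij => by
    rw [conormFunction_conormEdge B.conorm_comm hij, rootProduct]
  have hform : ∀ (B : ObtuseSuperbase) (R : RootInvariant), HasRootForm B.rootProduct R ↔
      HasRootForm (fun i j => √(conormFunction B.conorm (conormEdge i j))) R := by
    intro B R
    refine exists_congr fun σ => ?_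
    have hs : ∀ i j : Fin 4, i ≠ j →
        √(conormFunction B.conorm (conormEdge (σ i) (σ j))) = B.rootProduct (σ i) (σ j) :=
      fun i j hij => hedge B _ _ (σ.injective.ne hij)
    constructor <;> intro h
    · exact h.congr (hs _ _ (by decide)) (hs _ _ (by decide)) (hs _ _ (by decide))
        (hs _ _ (by decide)) (hs _ _ (by decide)) (hs _ _ (by decide))
    · exact h.congr (hs _ _ (by decide)).symm (hs _ _ (by decide)).symm (hs _ _ (by decide)).symm
        (hs _ _ (by decide)).symm (hs _ _ (by decide)).symm (hs _ _ (by decide)).symm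
  rw [hform] at hR ⊢
  exact hR.of_conorm_automorphism (q := fun u => √(conormFunction B.conorm u))
    (q' := fun u => √(conormFunction B'.conorm u)) hadd hinj (fun u => by rw [hg])
    (by rw [conormFunction_conormFull, Real.sqrt_zero])
    (by rw [conormFunction_conormFull, Real.sqrt_zero])

end ObtuseSuperbase

end Vonorm

/-! ### Selling's reduction: every lattice has an obtuse superbase. -/

section Selling

/-- A superbase of a lattice: generators whose sum vanishes. -/
def IsSuperbaseOf (v : Fin 4 → E3) (Λ : Submodule ℤ E3) : Prop :=
  ∑ i, v i = 0 ∧ Submodule.span ℤ (Set.range v) = Λ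

theorem IsLattice3.exists_isSuperbaseOf {Λ : Submodule ℤ E3} (hΛ : IsLattice3 Λ) :
    ∃ v, IsSuperbaseOf v Λ := by
  obtain ⟨b, rfl⟩ := hΛ
  refine ⟨Fin.cons (-∑ i, b i) b, ?_, ?_⟩
  · rw [Fin.sum_univ_succ]
    simp
  · rw [Fin.range_cons, Submodule.span_insert_eq_span]
    exact neg_mem (sum_mem fun i _ => Submodule.subset_span ⟨i, rfl⟩)

/-- Selling's reduction step shortens a superbase that is not obtuse. -/
theorem IsSuperbaseOf.exists_shorter {v : Fin 4 → E3} {Λ : Submodule ℤ E3}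
    (hv : IsSuperbaseOf v Λ) {i j : Fin 4} (hij : i ≠ j) (h : 0 < ⟪v i, v j⟫) :
    ∃ v', IsSuperbaseOf v' Λ ∧ ∑ k, ‖v' k‖ ^ 2 < ∑ k, ‖v k‖ ^ 2 := by
  obtain ⟨hsum, hspan⟩ := hv
  -- The new superbase has `-v i` for `v i`, keeps `v j`, and adds `v i` to the other two vectors:
  -- `c` is -2, 0, 1, 1. The sum of squared norms drops by `2 * ⟪v i, v j⟫`.
  set c : Fin 4 → ℤ := fun k => 1 - (if k = i then 3 else 0) - (if k = j then 1 else 0) with hc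
  have hci : c i = -2 := by simp [hc, hij]
  have hc1 : ∑ k, c k = 0 := by simp [hc, Finset.sum_sub_distrib]
  have hc2 : ∑ k, c k ^ 2 = 6 := by
    have : ∀ i j : Fin 4, i ≠ j → ∑ k : Fin 4,
        ((1 : ℤ) - (if k = i then 3 else 0) - (if k = j then 1 else 0)) ^ 2 = 6 := by decide
    exact this i j hij
  have hmem : ∀ k, v k ∈ Λ := fun k => hspan ▸ Submodule.subset_span ⟨k, rfl⟩
  refine ⟨fun k => v k + c k • v i, ⟨?_, ?_⟩, ?_⟩
  · rw [Finset.sum_add_distrib, ← Finset.sum_smul, hc1, hsum]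
    simp
  · apply le_antisymm
    · rw [Submodule.span_le]
      rintro _ ⟨k, rfl⟩
      exact add_mem (hmem k) (Submodule.smul_mem _ _ (hmem i))
    · rw [← hspan, Submodule.span_le]
      set Λ' := Submodule.span ℤ (Set.range fun k => v k + c k • v i) with hΛ'
      have hmem' : ∀ k, v k + c k • v i ∈ Λ' := fun k => Submodule.subset_span ⟨k, rfl⟩
      have hi : v i ∈ Λ' := by
        have := neg_mem (hmem' i)
        rw [hci] at this
        convert this using 1
        module
      rintro _ ⟨k, rfl⟩
      have := sub_mem (hmem' k) (Submodule.smul_mem _ (c k) hi)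
      rwa [add_sub_cancel_right] at this
  · have hnorm : ∀ k, ‖v k + c k • v i‖ ^ 2 =
        ‖v k‖ ^ 2 + 2 * ((c k : ℝ) * ⟪v k, v i⟫) + ((c k ^ 2 : ℤ) : ℝ) * ‖v i‖ ^ 2 := by
      intro k
      rw [← Int.cast_smul_eq_zsmul ℝ, norm_add_sq_real, inner_smul_right, norm_smul, mul_pow,
        Real.norm_eq_abs, sq_abs]
      push_cast
      ring
    have hin : ∑ k, (c k : ℝ) * ⟪v k, v i⟫ = -3 * ‖v i‖ ^ 2 - ⟪v i, v j⟫ := by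
      have h0 : ∑ k, ⟪v k, v i⟫ = 0 := by rw [← sum_inner, hsum, inner_zero_left]
      have : ∀ k, (c k : ℝ) * ⟪v k, v i⟫ = ⟪v k, v i⟫ - (if k = i then 3 * ⟪v k, v i⟫ else 0) -
          (if k = j then ⟪v k, v i⟫ else 0) := by
        intro k
        simp only [hc]
        split_ifs <;> push_cast <;> ring
      simp only [this, Finset.sum_sub_distrib, h0, Finset.sum_ite_eq', Finset.mem_univ, if_true,
        real_inner_self_eq_norm_sq]
      rw [real_inner_comm]
      ring
    simp only [hnorm, Finset.sum_add_distrib, ← Finset.mul_sum, ← Finset.sum_mul, hin,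
      ← Int.cast_sum, hc2]
    push_cast
    linarith

/-- Every lattice has an obtuse superbase. -/
theorem IsLattice3.exists_obtuseSuperbase {Λ : Submodule ℤ E3} (hΛ : IsLattice3 Λ) :
    ∃ B : ObtuseSuperbase, B.lattice = Λ := by
  obtain ⟨v₀, hv₀⟩ := hΛ.exists_isSuperbaseOf
  obtain ⟨b, hb⟩ := hΛ
  set C := ∑ k, ‖v₀ k‖ ^ 2 with hC
  -- A lattice has finitely many vectors in a ball, so some superbase minimises the sum of squared
  -- norms; a reduction step would contradict this unless it is obtuse.
  have hfin : {v | IsSuperbaseOf v Λ ∧ ∑ k, ‖v k‖ ^ 2 ≤ C}.Finite := by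
    have h1 : (Metric.closedBall (0 : E3) √C ∩ (Λ : Set E3)).Finite := by
      rw [hb]
      exact ZSpan.setFinite_inter b Metric.isBounded_closedBall
    refine (Set.Finite.pi' fun _ : Fin 4 => h1).subset ?_
    rintro v ⟨⟨-, hspan⟩, hle⟩ k
    refine ⟨?_, hspan ▸ Submodule.subset_span ⟨k, rfl⟩⟩
    rw [mem_closedBall_zero_iff]
    apply Real.le_sqrt_of_sq_le
    exact (Finset.single_le_sum (f := fun k => ‖v k‖ ^ 2) (fun _ _ => sq_nonneg _)
      (Finset.mem_univ k)).trans hle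
  obtain ⟨v, ⟨hv, hvC⟩, hmin⟩ := Set.exists_min_image _ (fun v : Fin 4 → E3 => ∑ k, ‖v k‖ ^ 2)
    hfin ⟨v₀, hv₀, le_rfl⟩
  have hobtuse : ∀ i j, i ≠ j → 0 ≤ -⟪v i, v j⟫ := by
    intro i j hij
    by_contra! hlt
    obtain ⟨v', hv', hlt'⟩ := hv.exists_shorter hij (by linarith)
    exact absurd (hmin v' ⟨hv', hlt'.le.trans hvC⟩) (not_le.2 hlt')
  have hv0 : v 0 = -v 1 - v 2 - v 3 := by
    have := hv.1
    rw [Fin.sum_univ_four, add_assoc, add_assoc] at this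
    rw [eq_neg_of_add_eq_zero_left this]
    abel
  have hspan : Submodule.span ℤ {v 1, v 2, v 3} = Λ := by
    rw [← hv.2]
    apply le_antisymm
    · refine Submodule.span_mono ?_
      rintro _ (rfl | rfl | rfl) <;> exact ⟨_, rfl⟩
    · rw [Submodule.span_le]
      have h1 : v 1 ∈ Submodule.span ℤ {v 1, v 2, v 3} := Submodule.subset_span (by simp)
      have h2 : v 2 ∈ Submodule.span ℤ {v 1, v 2, v 3} := Submodule.subset_span (by simp)
      have h3 : v 3 ∈ Submodule.span ℤ {v 1, v 2, v 3} := Submodule.subset_span (by simp)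
      rintro _ ⟨k, rfl⟩
      fin_cases k
      · change v 0 ∈ _
        rw [hv0]
        exact sub_mem (sub_mem (neg_mem h1) h2) h3
      · exact h1
      · exact h2
      · exact h3
  have hrange : Set.range ![v 1, v 2, v 3] = {v 1, v 2, v 3} := by
    ext y
    simp only [Matrix.range_cons, Matrix.range_empty, Set.mem_union, Set.mem_singleton_iff,
      Set.mem_insert_iff, Set.mem_empty_iff_false, or_false]
  have hli : LinearIndependent ℝ ![v 1, v 2, v 3] := by
    apply linearIndependent_of_top_le_span_of_card_eq_finrank
    · rw [hrange, ← b.span_eq, Submodule.span_le]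
      have h1 : (Λ : Set E3) ⊆ Submodule.span ℝ {v 1, v 2, v 3} := by
        rw [← hspan]
        exact Submodule.span_subset_span ℤ ℝ _
      exact subset_trans (by rw [hb]; exact Submodule.subset_span) h1
    · simp
  exact ⟨⟨v, hli, hv0, hobtuse⟩, hspan⟩

end Selling

/-! ### Transport along isometries. -/

section Isometry

/-- An isometry between lattices transports obtuse superbases. -/
theorem LatticesIsometric.exists_obtuseSuperbase {B : ObtuseSuperbase} {Λ' : Submodule ℤ E3}
    (h : LatticesIsometric B.lattice Λ') :
    ∃ B' : ObtuseSuperbase, B'.lattice = Λ' ∧ B'.rootProduct = B.rootProduct := by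
  obtain ⟨f, hf, hΛ⟩ := h
  -- An isometry is affine but may move the origin. Since `f 0` lies in `Λ'`, the linear part
  -- already maps the lattice onto `Λ'`.
  set g : E3 →ₗᵢ[ℝ] E3 := hf.affineIsometryOfStrictConvexSpace.linearIsometry with hg
  have hfg : ∀ x, f x = g x + f 0 := by
    intro x
    have := hf.affineIsometryOfStrictConvexSpace.map_vadd 0 x
    simpa using this
  have hmem : ∀ {x}, x ∈ B.lattice → f x ∈ Λ' := fun {x} hx => by
    have : f x ∈ f '' (B.lattice : Set E3) := ⟨x, hx, rfl⟩
    rwa [hΛ] at this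
  have h0 : f 0 ∈ Λ' := hmem (zero_mem _)
  let B' : ObtuseSuperbase :=
    { v := fun i => g (B.v i)
      linearIndependent := by
        have := B.linearIndependent.map' g.toLinearMap (LinearMap.ker_eq_bot.2 g.injective)
        have e : g.toLinearMap ∘ ![B.v 1, B.v 2, B.v 3] =
            ![g (B.v 1), g (B.v 2), g (B.v 3)] := by
          funext i
          fin_cases i <;> rfl
        rwa [e] at this
      v_zero := by rw [B.v_zero]; simp
      obtuse := fun i j hij => by rw [g.inner_map_map]; exact B.obtuse i j hij }
  refine ⟨B', ?_, ?_⟩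
  · ext y
    have hy : y ∈ B'.lattice ↔ ∃ x ∈ B.lattice, g x = y := by
      simp only [ObtuseSuperbase.mem_lattice_iff]
      constructor
      · rintro ⟨n, rfl⟩
        exact ⟨_, ⟨n, rfl⟩, by simp [B']⟩
      · rintro ⟨_, ⟨n, rfl⟩, rfl⟩
        exact ⟨n, by simp [B']⟩
    rw [hy]
    constructor
    · rintro ⟨x, hx, rfl⟩
      have := sub_mem (hmem hx) h0
      rwa [hfg x, add_sub_cancel_right] at this
    · intro hy
      have h1 : y + f 0 ∈ f '' (B.lattice : Set E3) := by rw [hΛ]; exact add_mem hy h0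
      obtain ⟨x, hx, hxy⟩ := h1
      rw [hfg x] at hxy
      exact ⟨x, hx, add_right_cancel hxy⟩
  · funext i j
    simp only [ObtuseSuperbase.rootProduct, ObtuseSuperbase.conorm, B', g.inner_map_map]

theorem LatticesIsometric.isRootArrangement_iff {B B' : ObtuseSuperbase}
    (h : LatticesIsometric B.lattice B'.lattice) (R : RootInvariant) :
    IsRootArrangement B R ↔ IsRootArrangement B' R := by
  obtain ⟨B₁, hΛ, hr⟩ := h.exists_obtuseSuperbase
  rw [isRootArrangement_iff_hasRootForm, isRootArrangement_iff_hasRootForm, ← hr]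
  exact ⟨ObtuseSuperbase.hasRootForm_of_lattice_eq hΛ.symm,
    ObtuseSuperbase.hasRootForm_of_lattice_eq hΛ⟩

/-- The two choices are made from equal predicates. -/
theorem LatticesIsometric.RI_eq {B B' : ObtuseSuperbase}
    (h : LatticesIsometric B.lattice B'.lattice) : B.RI = B'.RI := by
  have : IsRootInvariant B = IsRootInvariant B' := by
    funext R
    simp only [IsRootInvariant, h.isRootArrangement_iff]
  rw [ObtuseSuperbase.RI, ObtuseSuperbase.RI, this]

end Isometry

/-! ### The main theorem. -/

theorem mainTheorem2 :
    -- `RI(B)` is well defined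
    (∀ B : ObtuseSuperbase, ∃! R : RootInvariant, IsRootInvariant B R) ∧
    -- obtuse superbases of isometric lattices have equal root invariants, however ties are broken
    (∀ B B' : ObtuseSuperbase, LatticesIsometric B.lattice B'.lattice →
      B.RI = B'.RI ∧ ∀ R : RootInvariant, IsRootArrangement B R ↔ IsRootArrangement B' R) ∧
    -- hence `RI` is an isometry invariant of lattices
    (∃! RIΛ : Lattice3 → RootInvariant,
      (∀ (Λ : Lattice3) (B : ObtuseSuperbase), B.lattice = Λ.1 → RIΛ Λ = B.RI) ∧
      (∀ Λ Λ' : Lattice3, LatticesIsometric Λ.1 Λ'.1 → RIΛ Λ = RIΛ Λ')) := by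
  refine ⟨existsUnique_isRootInvariant, fun B B' h => ⟨h.RI_eq, h.isRootArrangement_iff⟩, ?_⟩
  choose S hS using fun Λ : Lattice3 => Λ.2.exists_obtuseSuperbase
  refine ⟨fun Λ => (S Λ).RI, ⟨fun Λ B hB => ?_, fun Λ Λ' h => ?_⟩, ?_⟩
  · exact LatticesIsometric.RI_eq ⟨id, isometry_id, by rw [Set.image_id, hS, hB]⟩
  · exact LatticesIsometric.RI_eq (by rwa [hS, hS])
  -- Every lattice has an obtuse superbase, so its value is forced.
  · rintro φ ⟨hφ, -⟩
    funext Λ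
    exact hφ Λ (S Λ) (hS Λ)
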